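/- **Diagrams.** A ZX-diagram with $n$ inputs and $m$ outputs is built by sequential composition (stacking, read from bottom to top) and parallel composition from wires (which may cross and bend), green and red spiders with any numbers of inputs and outputs and a phase $\alpha\in\mathbb R/2\pi\mathbb Z$, Hadamard nodes (one input, one output) and star nodes (no legs). Its interpretation $[\![D]\!]$ is a $2^m\times 2^n$ complex matrix: composition is matrix product, parallel composition is the tensor product, wires, crossings and bent wires are the identity, swaps, $|00\rangle+|11\rangle$ and $\langle 00|+\langle 11|$; a green spider is $|0\rangle^{\otimes m}\langle 0|^{\otimes n}+e^{i\alpha}|1\rangle^{\otimes m}\langle 1|^{\otimes n}$, a red spider is $|+\rangle^{\otimes m}\langle +|^{\otimes n}+e^{i\alpha}|-\rangle^{\otimes m}\langle -|^{\otimes n}$, the Hadamard node is $|+\rangle\langle 0|+|-\rangle\langle 1|$ and the star is $\tfrac12$. **Rules.** Write $g_\alpha,r_\beta$ for green and red spiders, a *phase shift* being a spider with one input and one output, and $(g_\alpha|r_\beta)$ for the scalar diagram in which a one-legged $g_\alpha$ and a one-legged $r_\beta$ are joined by a wire. Two diagrams are equal in the scalar-free ZX-calculus if one can be rewritten into the other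 by the following rules, applied to any part of a diagram, in either direction, also upside-down and also with the colours exchanged, where only the topology of a diagram matters. 1. Spider: two spiders of the same colour joined by at least one wire merge, and their phases add. 2. Loop: a self-loop on a spider may be removed. 3. Cup: $g_0$ with no inputs and two outputs is a bent wire. 4. Bialgebra: ($r_0$ with two inputs and one output, followed by $g_0$ with one input and two outputs) equals $(g_0|r_0)$ together with (two copies of that $g_0$, the two middle wires crossed, then two copies of that $r_0$). 5. Copy: $(g_0|r_0)$ together with ($r_0$ with one output, followed by $g_0$ with one input and two outputs) equals two copies of $r_0$ with one output. 6. $\pi$-copy: the phase shift $r_\pi$ before a $g_0$ with one input and $m$ outputs equals $r_\pi$ on each of the $m$ outputs. 7. $\pi$-commutation: $(g_0|r_0)$ together with (phase shift $g_\alpha$, then $r_\pi$) equals $(g_\alpha|r_\pi)$ together with (phase shift $r_\pi$, then $g_{-\alpha}$). 8. Colour change: a green spider with a Hadamard node on every leg is the red spider with the same phase. 9. Euler decomposition: two copies of $(g_0|r_0)$ and a Hadamard node equal $(g_{-\pi/2}|r_{-\pi/2})$ and the phase shifts $g_{\pi/2},r_{\pi/2},g_{\pi/2}$ in sequence. 10.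 Zero and zero scalar: next to a legless $g_\pi$, a wire may be cut into a one-input $g_0$ below and a one-output $r_0$ above, and a legless $g_\alpha$ may be removed. 11. Scalar rule: the scalars $(g_0|r_0)$, $(g_{k\pi/4}|r_\pi)$ with $k\in\mathbb Z$, and $(g_{-\pi/2}|r_{-\pi/2})$ may be removed. A *line diagram* is a sequential composite of finitely many phase shifts and Hadamard nodes (possibly none); it is *Clifford+T* if all its phases are integer multiples of $\pi/4$ and *Clifford* if all are integer multiples of $\pi/2$. **Normal forms.** Let $R$ be the red phase shift $\pi/2$ and $S,T$ the green phase shifts $\pi/2,\pi/4$; products are read from right (bottom) to left (top). Put $\mathcal W=\{I,R,SR\}$, $\mathcal V=\{TR,TSR\}$, and let $\mathcal U$ consist of the 24 line diagrams $TS^aR^b$ ($0\le a,b\le 3$) and $TS^aRS^{\pm1}$ ($0\le a\le3$), adjacent green phases of one factor being merged. A normal form is a diagram $WV_n\cdots V_1U$ with $n\ge 0$, $W\in\mathcal W$, $V_i\in\mathcal V$, $U\in\mathcal U$. **Theorem.** Let $P\subseteq\mathbb R/2\pi\mathbb Z$ be any subgroup containing $\pi/4$ (for instance all phases, or only the multiples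 of $\pi/4$), and restrict the calculus to rule instances in which all phases lie in $P$. 1. The ZX-calculus is complete (and sound) for the scalar-free single-qubit Clifford+T group: two Clifford+T line diagrams $D,E$ can be rewritten into each other if and only if $[\![D]\!]=z\,[\![E]\!]$ for some complex $z\neq0$. 2. Every Clifford+T line diagram can be rewritten either to a Clifford line diagram or to a normal form, and never to both. 3. The normal form is unique: if two normal forms can be rewritten into each other, or if their interpretations are equal up to a non-zero scalar factor, then they are identical, i.e. have the same $n$, $W$, $V_1,\dots,V_n$ and $U$. -/

import Mathlib

namespace ZX

/-- The two colours of spiders. -/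
inductive Colour
  | green
  | red
  deriving DecidableEq

/-- The colour that is not `c`. -/
def Colour.other : Colour → Colour
  | .green => .red
  | .red => .green

/-- ZX-calculus diagrams with `n` inputs and `m` outputs. Phases are real numbers modulo `2π`.
`perm σ` consists of wires only, the `i`-th input being connected to the output `σ i`, so that it
comprises identity wires and all wire crossings. `comp D E` is sequential composition (first `D`,
at the bottom, then `E` on top of it) and `tensor D E` puts `D` to the left of `E`.
Diagrams that differ only in their layout are identified by the topological part of `Rule`. -/
inductive Diagram : ℕ → ℕ → Type
  | perm {n m : ℕ} (σ : Fin n ≃ Fin m) : Diagram n m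
  | cup : Diagram 0 2
  | cap : Diagram 2 0
  | spider (c : Colour) (α : Real.Angle) (n m : ℕ) : Diagram n m
  | hadamard : Diagram 1 1
  | starNode : Diagram 0 0
  | comp {n m k : ℕ} (D : Diagram n m) (E : Diagram m k) : Diagram n k
  | tensor {n m k l : ℕ} (D : Diagram n m) (E : Diagram k l) : Diagram (n + k) (m + l)

namespace Diagram

/-- `n` parallel wires; for `n = 0` the empty diagram. -/
def wires (n : ℕ) : Diagram n n := perm (Equiv.refl (Fin n))

/-- A scalar diagram put next to a diagram. -/
def scale {n m : ℕ} (D : Diagram n m) (s : Diagram 0 0) : Diagram n m := tensor D s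

/-- The spider with one input and one output. -/
def phase (c : Colour) (α : Real.Angle) : Diagram 1 1 := spider c α 1 1

/-- The spider with no inputs and one output. -/
def state (c : Colour) (α : Real.Angle) : Diagram 0 1 := spider c α 0 1

/-- The spider with one input and no outputs. -/
def effect (c : Colour) (α : Real.Angle) : Diagram 1 0 := spider c α 1 0

/-- The scalar made of two one-legged spiders joined by a wire. -/
def innerprod (c : Colour) (α : Real.Angle) (d : Colour) (β : Real.Angle) : Diagram 0 0 :=
  comp (state c α) (effect d β)

/-- `n` parallel Hadamard nodes. -/
def hadamards : (n : ℕ) → Diagram n n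
  | 0 => wires 0
  | n + 1 => tensor (hadamards n) hadamard

/-- `n` parallel phase shifts, all with the same colour and phase. -/
def phases (c : Colour) (α : Real.Angle) : (n : ℕ) → Diagram n n
  | 0 => wires 0
  | n + 1 => tensor (phases c α n) (phase c α)

/-- Turning a diagram upside-down. -/
def flip : {n m : ℕ} → Diagram n m → Diagram m n
  | _, _, perm σ => perm σ.symm
  | _, _, cup => cap
  | _, _, cap => cup
  | _, _, spider c α n m => spider c α m n
  | _, _, hadamard => hadamard
  | _, _, starNode => starNode
  | _, _, comp D E => comp E.flip D.flip
  | _, _, tensor D E => tensor D.flip E.flip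

/-- All phases that occur in the diagram lie in `P`. -/
def PhasesIn (P : Set Real.Angle) : {n m : ℕ} → Diagram n m → Prop
  | _, _, spider _ α _ _ => α ∈ P
  | _, _, comp D E => D.PhasesIn P ∧ E.PhasesIn P
  | _, _, tensor D E => D.PhasesIn P ∧ E.PhasesIn P
  | _, _, _ => True

end Diagram

/-- The basis vectors belonging to a colour, by their (real) coordinates: `|0⟩, |1⟩` for green
and `|+⟩, |-⟩` for red. `ket c b i` is the `i`-th coordinate of the `b`-th vector. -/
noncomputable def ket : Colour → Fin 2 → Fin 2 → ℂ
  | .green, b, i => if i = b then 1 else 0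
  | .red, b, i => if b = 1 ∧ i = 1 then -(1 / (Real.sqrt 2 : ℂ)) else 1 / (Real.sqrt 2 : ℂ)

/-- The usual interpretation of diagrams as matrices. The computational basis of `n` qubits is
indexed by `Fin n → Fin 2`; rows belong to outputs and columns to inputs. -/
noncomputable def interp :
    {n m : ℕ} → Diagram n m → Matrix (Fin m → Fin 2) (Fin n → Fin 2) ℂ
  | _, _, .perm σ => Matrix.of fun f g => if ∀ i, f (σ i) = g i then 1 else 0
  | _, _, .cup => Matrix.of fun f _ => if f 0 = f 1 then 1 else 0
  | _, _, .cap => Matrix.of fun _ g => if g 0 = g 1 then 1 else 0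
  | _, _, .spider c α _ _ => Matrix.of fun f g =>
      (∏ i, ket c 0 (f i)) * (∏ j, ket c 0 (g j)) +
        (α.toCircle : ℂ) * ((∏ i, ket c 1 (f i)) * (∏ j, ket c 1 (g j)))
  | _, _, .hadamard => Matrix.of fun f g => ket .red (g 0) (f 0)
  | _, _, .starNode => Matrix.of fun _ _ => 1 / 2
  | _, _, .comp D E => interp E * interp D
  | _, _, .tensor D E => Matrix.of fun f g =>
      interp D (fun i => f (Fin.castAdd _ i)) (fun j => g (Fin.castAdd _ j)) *
        interp E (fun i => f (Fin.natAdd _ i)) (fun j => g (Fin.natAdd _ j))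

/-- Equality of matrices up to a non-zero scalar factor. -/
def EqUpToScalar {ι κ : Type} (A B : Matrix ι κ ℂ) : Prop :=
  ∃ z : ℂ, z ≠ 0 ∧ A = z • B

open Diagram in
/-- The rules of the scalar-free ZX-calculus (each of them is also used upside-down and in both
directions). Where a colour `c` is universally quantified, the rule holds with colours
swapped. The first group expresses that only the topology of a diagram matters. In the second
group the star rule has been replaced by the scalar rules. -/
inductive Rule : {n m : ℕ} → Diagram n m → Diagram n m → Prop
  -- symmetric monoidal structure
  | comp_assoc {n m k l : ℕ} (A : Diagram n m) (B : Diagram m k) (C : Diagram k l) :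
      Rule (comp (comp A B) C) (comp A (comp B C))
  | wires_comp {n m : ℕ} (A : Diagram n m) : Rule (comp (wires n) A) A
  | comp_wires {n m : ℕ} (A : Diagram n m) : Rule (comp A (wires m)) A
  | interchange {n m k n' m' k' : ℕ} (A : Diagram n m) (B : Diagram m k)
      (A' : Diagram n' m') (B' : Diagram m' k') :
      Rule (tensor (comp A B) (comp A' B')) (comp (tensor A A') (tensor B B'))
  | tensor_assoc {n m n' m' n'' m'' : ℕ} (A : Diagram n m) (B : Diagram n' m')
      (C : Diagram n'' m'') :
      Rule (comp (tensor (tensor A B) C) (perm (finCongr (Nat.add_assoc m m' m''))))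
        (comp (perm (finCongr (Nat.add_assoc n n' n''))) (tensor A (tensor B C)))
  | tensor_empty {n m : ℕ} (A : Diagram n m) : Rule (tensor A (wires 0)) A
  | empty_tensor {n m : ℕ} (A : Diagram n m) :
      Rule (comp (tensor (wires 0) A) (perm (finCongr (Nat.zero_add m))))
        (comp (perm (finCongr (Nat.zero_add n))) A)
  | perm_comp {n m k : ℕ} (σ : Fin n ≃ Fin m) (τ : Fin m ≃ Fin k) :
      Rule (comp (perm σ) (perm τ)) (perm (σ.trans τ))
  | perm_tensor {n m k l : ℕ} (σ : Fin n ≃ Fin m) (τ : Fin k ≃ Fin l) :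
      Rule (tensor (perm σ) (perm τ))
        (perm ((finSumFinEquiv.symm.trans (σ.sumCongr τ)).trans finSumFinEquiv))
  | swap_natural {n m k l : ℕ} (A : Diagram n m) (B : Diagram k l) :
      Rule (comp (tensor A B) (perm finAddFlip)) (comp (perm finAddFlip) (tensor B A))
  -- compact structure
  | snake : Rule (comp (tensor cup (wires 1)) (tensor (wires 1) cap) : Diagram 1 1) (wires 1)
  | cup_swap : Rule (comp cup (perm (Equiv.swap 0 1))) cup
  -- the legs of a spider are not ordered
  | spider_perm (c : Colour) (α : Real.Angle) (n m : ℕ) (σ : Equiv.Perm (Fin m)) :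
      Rule (comp (spider c α n m) (perm σ)) (spider c α n m)
  -- spider rule: two spiders of the same colour joined by one or more wires
  | spider (c : Colour) (α β : Real.Angle) (n m k l j : ℕ) :
      Rule (comp (comp (tensor (spider c α n (m + (j + 1))) (wires k))
            (perm (finCongr (Nat.add_assoc m (j + 1) k))))
          (tensor (wires m) (spider c β (j + 1 + k) l)))
        (spider c (α + β) (n + k) (m + l))
  | loop (c : Colour) (α : Real.Angle) (n m : ℕ) :
      Rule (comp (spider c α n (m + 2)) (tensor (wires m) cap)) (spider c α n m)
  | cup_rule (c : Colour) : Rule (spider c 0 0 2) cup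
  | bialgebra (c : Colour) :
      Rule (scale (comp (comp (tensor (spider c 0 1 2) (spider c 0 1 2))
            (perm (Equiv.swap (1 : Fin 4) 2)))
          (tensor (spider c.other 0 2 1) (spider c.other 0 2 1))) (innerprod c 0 c.other 0))
        (comp (spider c.other 0 2 1) (spider c 0 1 2))
  | copy (c : Colour) :
      Rule (scale (comp (state c.other 0) (spider c 0 1 2)) (innerprod c 0 c.other 0))
        (tensor (state c.other 0) (state c.other 0))
  | pi_copy (c : Colour) (m : ℕ) :
      Rule (comp (phase c.other (Real.pi : ℝ)) (spider c 0 1 m))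
        (comp (spider c 0 1 m) (phases c.other (Real.pi : ℝ) m))
  | pi_commutation (c : Colour) (α : Real.Angle) :
      Rule (scale (comp (phase c α) (phase c.other (Real.pi : ℝ))) (innerprod c 0 c.other 0))
        (scale (comp (phase c.other (Real.pi : ℝ)) (phase c (-α)))
          (innerprod c α c.other (Real.pi : ℝ)))
  | colour_change (c : Colour) (α : Real.Angle) (n m : ℕ) :
      Rule (comp (comp (hadamards n) (spider c α n m)) (hadamards m)) (spider c.other α n m)
  | euler (c : Colour) :
      Rule (scale (scale hadamard (innerprod c 0 c.other 0)) (innerprod c 0 c.other 0))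
        (scale (comp (comp (phase c (Real.pi / 2 : ℝ)) (phase c.other (Real.pi / 2 : ℝ)))
            (phase c (Real.pi / 2 : ℝ)))
          (innerprod c (-(Real.pi / 2) : ℝ) c.other (-(Real.pi / 2) : ℝ)))
  | zero (c : Colour) :
      Rule (scale (wires 1) (spider c (Real.pi : ℝ) 0 0))
        (scale (comp (effect c 0) (state c.other 0)) (spider c (Real.pi : ℝ) 0 0))
  | zero_scalar (c : Colour) (α : Real.Angle) :
      Rule (tensor (spider c (Real.pi : ℝ) 0 0) (spider c α 0 0)) (spider c (Real.pi : ℝ) 0 0)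
  -- scalar rule
  | scalar_zero (c : Colour) : Rule (innerprod c 0 c.other 0) (wires 0)
  | scalar_pi (c : Colour) (k : ℤ) :
      Rule (innerprod c (k * (Real.pi / 4) : ℝ) c.other (Real.pi : ℝ)) (wires 0)
  | scalar_pi_div_two (c : Colour) :
      Rule (innerprod c (-(Real.pi / 2) : ℝ) c.other (-(Real.pi / 2) : ℝ)) (wires 0)

/-- Derivability in the scalar-free ZX-calculus whose phases are restricted to `P`: the
congruence generated by those instances of the rules in which all phases lie in `P`. -/
inductive Derivable (P : Set Real.Angle) : {n m : ℕ} → Diagram n m → Diagram n m → Prop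
  | rule {n m : ℕ} {D E : Diagram n m} (h : Rule D E) (hD : D.PhasesIn P) (hE : E.PhasesIn P) :
      Derivable P D E
  | rule_flip {n m : ℕ} {D E : Diagram n m} (h : Rule D E) (hD : D.PhasesIn P)
      (hE : E.PhasesIn P) : Derivable P D.flip E.flip
  | refl {n m : ℕ} (D : Diagram n m) : Derivable P D D
  | symm {n m : ℕ} {D E : Diagram n m} : Derivable P D E → Derivable P E D
  | trans {n m : ℕ} {D E F : Diagram n m} :
      Derivable P D E → Derivable P E F → Derivable P D F
  | comp {n m k : ℕ} {D D' : Diagram n m} {E E' : Diagram m k} :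
      Derivable P D D' → Derivable P E E' → Derivable P (D.comp E) (D'.comp E')
  | tensor {n m k l : ℕ} {D D' : Diagram n m} {E E' : Diagram k l} :
      Derivable P D D' → Derivable P E E' → Derivable P (D.tensor E) (D'.tensor E')

/-- Line diagrams all of whose phases are integer multiples of `θ`. -/
inductive IsLine (θ : ℝ) : Diagram 1 1 → Prop
  | wire : IsLine θ (Diagram.wires 1)
  | hadamard : IsLine θ Diagram.hadamard
  | phase (c : Colour) (k : ℤ) : IsLine θ (Diagram.phase c (k * θ : ℝ))
  | comp {D E : Diagram 1 1} : IsLine θ D → IsLine θ E → IsLine θ (D.comp E)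

/-- The set `𝒲 = {I, R, SR}`, where `R` is the red `π/2` phase shift and `S` the green one. -/
inductive WGate
  | I
  | R
  | SR

/-- The diagram of an element of `𝒲`. -/
noncomputable def WGate.diagram : WGate → Diagram 1 1
  | .I => Diagram.wires 1
  | .R => Diagram.phase .red (Real.pi / 2 : ℝ)
  | .SR => (Diagram.phase .red (Real.pi / 2 : ℝ)).comp (Diagram.phase .green (Real.pi / 2 : ℝ))

/-- The set `𝒱 = {TR, TSR}`, where `T` is the green `π/4` phase shift. -/
inductive VGate
  | TR
  | TSR

/-- The diagram of an element of `𝒱`; in `TSR` the two green phases are merged. -/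
noncomputable def VGate.diagram : VGate → Diagram 1 1
  | .TR => (Diagram.phase .red (Real.pi / 2 : ℝ)).comp (Diagram.phase .green (Real.pi / 4 : ℝ))
  | .TSR =>
      (Diagram.phase .red (Real.pi / 2 : ℝ)).comp (Diagram.phase .green (3 * Real.pi / 4 : ℝ))

/-- The set `𝒰` of operators `TC`, where `C` runs through the unique representations
`S^a R^b` and `S^a R S^{±1}` of the 24 single-qubit Clifford operators. -/
inductive UGate
  | short (a b : Fin 4)
  | long (a : Fin 4) (sign : Bool)

/-- The diagram of an element of `𝒰`; adjacent green phases are merged. -/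
noncomputable def UGate.diagram : UGate → Diagram 1 1
  | .short a b =>
      (Diagram.phase .red ((b : ℕ) * (Real.pi / 2) : ℝ)).comp
        (Diagram.phase .green ((a : ℕ) * (Real.pi / 2) + Real.pi / 4 : ℝ))
  | .long a sign =>
      ((Diagram.phase .green (if sign then Real.pi / 2 else -(Real.pi / 2) : ℝ)).comp
        (Diagram.phase .red (Real.pi / 2 : ℝ))).comp
        (Diagram.phase .green ((a : ℕ) * (Real.pi / 2) + Real.pi / 4 : ℝ))

/-- The data `W`, `[V₁, …, Vₙ]`, `U` of a normal form `W Vₙ … V₁ U`, with `n ≥ 0`. -/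
structure NormalForm where
  W : WGate
  V : List VGate
  U : UGate

/-- The normal form diagram `W Vₙ … V₁ U`: from bottom to top `U`, `V₁`, …, `Vₙ`, `W`. -/
noncomputable def NormalForm.diagram (N : NormalForm) : Diagram 1 1 :=
  (N.V.foldl (fun D v => D.comp v.diagram) N.U.diagram).comp N.W.diagram

end ZX

/-!
The calculus is sound because every rule preserves the interpretation up to a non-zero scalar, and
turning a rule upside-down transposes both interpretations (`Rule.eqUpToScalar`, `interp_flip`,
`Derivable.eqUpToScalar`).

For completeness, the one-qubit diagrams with phases in `P` modulo derivability form a monoid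
`LineMonoid P`, in which the classes `T` of the green phase shift `π / 4` and `R` of the red phase
shift `π / 2` satisfy a short list of relations (`CliffordTRelations`, `cliffordTRelations`). A
Clifford+T line diagram is a product of `T` and `R`, a Clifford one is a product of `S = T ^ 2` and
`R`. The relations alone imply that a product of `S` and `R` is one of the 24 operators `S^a R^b`,
`S^a R S^{±1}` (`CliffordTRelations.exists_eq_clifford`), and that a product of `T` and `R` is
Clifford or a normal form (`CliffordTRelations.clifford_or_normalForm`). The reason for the latter
is that a factor `S` or `R ^ 2` to the left of `V` from `𝒱` can be moved through it, becoming a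
product of such factors, and is absorbed by `U`. So multiplying a normal form from the left by `T`
or `R` gives a normal form again, or a Clifford operator if `T` meets the `T` of `U`.

Uniqueness follows Matsumoto and Amano, in the form given to the argument by Giles and Selinger. An
operator up to a scalar acts by conjugation on the span of the Pauli matrices, and for a Clifford+T
operator this rotation has the form `B / √2 ^ k` with `B` a matrix over `ℤ[√2]` (`IsBloch`). For
`S` and `R` one has `k = 0`, and `B` is a signed permutation; for `T` one has `k = 1`, and modulo
`√2` the matrix `B` is `u uᵀ` with `u = (1, 1, 0)`. Since `uᵀ R u` and `uᵀ S R u` are odd, the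
product of the matrices along a normal form with `n` factors from `𝒱` is `w yᵀ ≠ 0` modulo `√2`,
where `k = n + 1` and the three possible vectors `w` belong to the three elements `W` of `𝒲`
(`normalForm_bloch_map`). So `k = n + 1` is the least denominator exponent, which separates normal
forms from Clifford operators and determines `n`, and `W` is determined by the operator. Removing
`W` and the following `T` leaves a shorter normal form or one of 24 distinct Clifford operators
(`NormalForm.eq_of_bloch_eq`).
-/

namespace ZX

/-! ### Entries of interpretations -/

section Entries

variable {n m k l : ℕ}

/-- The coefficient of the `b`-th basis vector in a spider of phase `α`. -/
noncomputable def phaseCoeff (α : Real.Angle) (b : Fin 2) : ℂ :=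
  if b = 1 then (α.toCircle : ℂ) else 1

theorem phaseCoeff_add (α β : Real.Angle) (b : Fin 2) :
    phaseCoeff (α + β) b = phaseCoeff α b * phaseCoeff β b := by
  unfold phaseCoeff; split_ifs <;> simp [Real.Angle.toCircle_add]

theorem phaseCoeff_zero (b : Fin 2) : phaseCoeff 0 b = 1 := by
  simp [phaseCoeff]

/-- Both bases of kets are orthonormal; as they are real, no conjugation is needed. -/
theorem sum_ket_mul_ket (c : Colour) (a b : Fin 2) :
    ∑ x, ket c a x * ket c b x = if a = b then 1 else 0 := by
  have h2 : (Real.sqrt 2 : ℂ) * Real.sqrt 2 = 2 := by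
    rw [← Complex.ofReal_mul]; norm_num
  cases c <;> fin_cases a <;> fin_cases b <;>
    (simp [ket, ← mul_inv, h2]; try norm_num)

/-- Both bases of kets are complete. -/
theorem sum_ket_mul_ket' (c : Colour) (x y : Fin 2) :
    ∑ b, ket c b x * ket c b y = if x = y then 1 else 0 := by
  have h2 : (Real.sqrt 2 : ℂ) * Real.sqrt 2 = 2 := by
    rw [← Complex.ofReal_mul]; norm_num
  cases c <;> fin_cases x <;> fin_cases y <;>
    (simp [ket, ← mul_inv, h2]; try norm_num)

theorem interp_spider (c : Colour) (α : Real.Angle) (f : Fin m → Fin 2) (g : Fin n → Fin 2) :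
    interp (.spider c α n m) f g =
      ∑ b, phaseCoeff α b * ((∏ i, ket c b (f i)) * ∏ j, ket c b (g j)) := by
  simp [interp, phaseCoeff]

theorem interp_perm (σ : Fin n ≃ Fin m) (f : Fin m → Fin 2) (g : Fin n → Fin 2) :
    interp (.perm σ) f g = if f ∘ σ = g then 1 else 0 := by
  simp [interp, funext_iff]

theorem interp_wires (f g : Fin n → Fin 2) :
    interp (Diagram.wires n) f g = if f = g then 1 else 0 := by
  simp [Diagram.wires, interp_perm]

theorem interp_hadamard (f g : Fin 1 → Fin 2) :
    interp .hadamard f g = ket .red (g 0) (f 0) := rfl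

theorem interp_tensor (D : Diagram n m) (E : Diagram k l) (f : Fin (m + l) → Fin 2)
    (g : Fin (n + k) → Fin 2) :
    interp (D.tensor E) f g =
      interp D (fun i => f (Fin.castAdd _ i)) (fun j => g (Fin.castAdd _ j)) *
        interp E (fun i => f (Fin.natAdd _ i)) (fun j => g (Fin.natAdd _ j)) := rfl

theorem interp_comp (D : Diagram n m) (E : Diagram m k) :
    interp (D.comp E) = interp E * interp D := rfl

theorem interp_comp_apply (D : Diagram n m) (E : Diagram m k)
    (f : Fin k → Fin 2) (g : Fin n → Fin 2) :
    interp (D.comp E) f g = ∑ h, interp E f h * interp D h g := rfl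

theorem interp_comp_perm (D : Diagram n m) (σ : Fin m ≃ Fin k)
    (f : Fin k → Fin 2) (g : Fin n → Fin 2) :
    interp (D.comp (.perm σ)) f g = interp D (f ∘ σ) g := by
  simp [interp_comp_apply, interp_perm]

theorem interp_perm_comp (σ : Fin n ≃ Fin m) (D : Diagram m k)
    (f : Fin k → Fin 2) (g : Fin n → Fin 2) :
    interp (Diagram.comp (.perm σ) D) f g = interp D f (g ∘ σ.symm) := by
  have h (x : Fin m → Fin 2) : x ∘ σ = g ↔ x = g ∘ σ.symm := by
    constructor <;> rintro rfl <;> simp [Function.comp_assoc]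
  simp [interp_comp_apply, interp_perm, h]

theorem interp_tensor_append (D : Diagram n m) (E : Diagram k l) (f : Fin m → Fin 2)
    (f' : Fin l → Fin 2) (g : Fin n → Fin 2) (g' : Fin k → Fin 2) :
    interp (D.tensor E) (Fin.append f f') (Fin.append g g') = interp D f g * interp E f' g' := by
  simp [interp]

/-- A sum over the basis of `m + k` qubits is a double sum over the bases of `m` and `k` qubits. -/
theorem sum_append {M : Type*} [AddCommMonoid M] (F : (Fin (m + k) → Fin 2) → M) :
    ∑ h, F h = ∑ h₁ : Fin m → Fin 2, ∑ h₂ : Fin k → Fin 2, F (Fin.append h₁ h₂) := by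
  rw [← (Fin.appendEquiv m k).sum_comp, Fintype.sum_prod_type]
  rfl

theorem forall_append {p : (Fin (m + k) → Fin 2) → Prop} :
    (∀ h, p h) ↔ ∀ (h₁ : Fin m → Fin 2) (h₂ : Fin k → Fin 2), p (Fin.append h₁ h₂) := by
  rw [← (Fin.appendEquiv m k).forall_congr_right, Prod.forall]
  rfl

theorem append_comp_finCongr_assoc (f : Fin n → Fin 2) (g : Fin m → Fin 2) (h : Fin k → Fin 2) :
    Fin.append f (Fin.append g h) ∘ finCongr (Nat.add_assoc n m k) =
      Fin.append (Fin.append f g) h := by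
  rw [Fin.append_assoc]; rfl

/-- Turning a diagram upside-down transposes its matrix (no entry is conjugated, since the basis
vectors of both colours are real). -/
theorem interp_flip (D : Diagram n m) : interp D.flip = (interp D).transpose := by
  induction D with
  | perm σ =>
    ext f g
    simp only [Diagram.flip, Matrix.transpose_apply, interp_perm]
    congr 1
    apply propext
    constructor <;> rintro rfl <;> simp [Function.comp_assoc]
  | cup => rfl
  | cap => rfl
  | spider c α n m =>
    ext f g
    simp only [Diagram.flip, Matrix.transpose_apply, interp_spider]
    simp only [mul_comm]
  | hadamard =>
    ext f g
    simp only [Diagram.flip, Matrix.transpose_apply, interp, Matrix.of_apply, ket]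
    simp only [and_comm]
  | starNode => rfl
  | comp D E hD hE => simp [Diagram.flip, interp_comp, hD, hE]
  | tensor D E hD hE => ext f g; simp [Diagram.flip, interp, hD, hE]

theorem sum_prod_mul_sum_ket (M : Fin 2 → Fin 2 → ℂ) (c : Colour) (u v : Fin 2 → ℂ)
    (f : Fin m → Fin 2) :
    ∑ h : Fin m → Fin 2, (∏ i, M (f i) (h i)) * ∑ b, u b * ((∏ i, ket c b (h i)) * v b) =
      ∑ b, u b * ((∏ i, ∑ x, M (f i) x * ket c b x) * v b) := by
  simp only [Finset.mul_sum]
  rw [Finset.sum_comm]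
  refine Finset.sum_congr rfl fun b _ => ?_
  rw [Fintype.prod_sum, Finset.sum_mul, Finset.mul_sum]
  refine Finset.sum_congr rfl fun h _ => ?_
  rw [Finset.prod_mul_distrib]
  ring

theorem sum_interp_spider_mul_prod (M : Fin 2 → Fin 2 → ℂ) (c : Colour) (α : Real.Angle)
    (f : Fin m → Fin 2) (g : Fin n → Fin 2) :
    ∑ h : Fin n → Fin 2, interp (.spider c α n m) f h * ∏ j, M (h j) (g j) =
      ∑ b, phaseCoeff α b * ((∏ i, ket c b (f i)) * ∏ j, ∑ x, ket c b x * M x (g j)) := by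
  simp only [interp_spider, Finset.sum_mul]
  rw [Finset.sum_comm]
  refine Finset.sum_congr rfl fun b _ => ?_
  rw [Fintype.prod_sum, Finset.mul_sum, Finset.mul_sum]
  refine Finset.sum_congr rfl fun h _ => ?_
  rw [Finset.prod_mul_distrib]
  ring

theorem sum_prod_ket_mul_prod_ket (c : Colour) (a b : Fin 2) :
    ∑ h : Fin n → Fin 2, (∏ i, ket c a (h i)) * ∏ i, ket c b (h i) =
      if a = b then 1 else if n = 0 then 1 else 0 := by
  simp only [← Finset.prod_mul_distrib]
  rw [← Fintype.prod_sum (fun _ x => ket c a x * ket c b x)]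
  simp only [sum_ket_mul_ket]
  split_ifs <;> simp [*]

theorem interp_hadamards (f g : Fin n → Fin 2) :
    interp (Diagram.hadamards n) f g = ∏ i, ket .red (g i) (f i) := by
  induction n with
  | zero => simp [Diagram.hadamards, interp_wires, Subsingleton.elim f g]
  | succ n ih =>
    rw [Diagram.hadamards]
    simp only [interp, Matrix.of_apply, ih, Fin.prod_univ_castSucc]
    rfl

theorem interp_phases (c : Colour) (α : Real.Angle) (f g : Fin n → Fin 2) :
    interp (Diagram.phases c α n) f g =
      ∏ i, interp (Diagram.phase c α) (fun _ => f i) (fun _ => g i) := by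
  induction n with
  | zero => simp [Diagram.phases, interp_wires, Subsingleton.elim f g]
  | succ n ih =>
    rw [Diagram.phases]
    simp only [interp, Matrix.of_apply, ih, Fin.prod_univ_castSucc]
    congr 2 <;> (ext i; fin_cases i; rfl)

end Entries

/-! ### Equality up to a scalar -/

section EqUpToScalar

variable {ι κ μ : Type}

theorem EqUpToScalar.of_eq {A B : Matrix ι κ ℂ} (h : A = B) : EqUpToScalar A B :=
  ⟨1, one_ne_zero, by simp [h]⟩

theorem EqUpToScalar.symm {A B : Matrix ι κ ℂ} (h : EqUpToScalar A B) : EqUpToScalar B A := by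
  obtain ⟨z, hz, rfl⟩ := h
  exact ⟨z⁻¹, inv_ne_zero hz, by simp [smul_smul, hz]⟩

theorem EqUpToScalar.trans {A B C : Matrix ι κ ℂ} (h : EqUpToScalar A B)
    (h' : EqUpToScalar B C) : EqUpToScalar A C := by
  obtain ⟨z, hz, rfl⟩ := h
  obtain ⟨w, hw, rfl⟩ := h'
  exact ⟨z * w, mul_ne_zero hz hw, by simp [smul_smul]⟩

theorem EqUpToScalar.mul [Fintype κ] {A A' : Matrix ι κ ℂ} {B B' : Matrix κ μ ℂ}
    (h : EqUpToScalar A A') (h' : EqUpToScalar B B') : EqUpToScalar (A * B) (A' * B') := by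
  obtain ⟨z, hz, rfl⟩ := h
  obtain ⟨w, hw, rfl⟩ := h'
  exact ⟨z * w, mul_ne_zero hz hw, by simp [smul_smul, mul_comm]⟩

theorem EqUpToScalar.transpose {A B : Matrix ι κ ℂ} (h : EqUpToScalar A B) :
    EqUpToScalar A.transpose B.transpose := by
  obtain ⟨z, hz, rfl⟩ := h
  exact ⟨z, hz, by simp⟩

theorem EqUpToScalar.tensor {n m k l : ℕ} {D D' : Diagram n m} {E E' : Diagram k l}
    (h : EqUpToScalar (interp D) (interp D')) (h' : EqUpToScalar (interp E) (interp E')) :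
    EqUpToScalar (interp (D.tensor E)) (interp (D'.tensor E')) := by
  obtain ⟨z, hz, hD⟩ := h
  obtain ⟨w, hw, hE⟩ := h'
  refine ⟨z * w, mul_ne_zero hz hw, ?_⟩
  ext f g
  simp only [interp, hD, hE, Matrix.smul_apply, Matrix.of_apply, smul_eq_mul]
  ring

theorem interp_scale {n m : ℕ} (D : Diagram n m) (s : Diagram 0 0) :
    interp (D.scale s) = interp s 0 0 • interp D := by
  ext f g
  simp only [Diagram.scale, interp, Matrix.of_apply, Matrix.smul_apply, smul_eq_mul]
  rw [mul_comm]
  congr 2 <;> exact Subsingleton.elim _ _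

theorem eqUpToScalar_scale {n m : ℕ} (D : Diagram n m) (s : Diagram 0 0)
    (hs : interp s 0 0 ≠ 0) : EqUpToScalar (interp (D.scale s)) (interp D) :=
  ⟨_, hs, interp_scale D s⟩

end EqUpToScalar

/-! ### Soundness of the rules -/

section Soundness

open Diagram

theorem interp_tensor_wires {n m k : ℕ} (D : Diagram n m) (f : Fin m → Fin 2)
    (f' g' : Fin k → Fin 2) (g : Fin n → Fin 2) :
    interp (D.tensor (wires k)) (Fin.append f f') (Fin.append g g') =
      if f' = g' then interp D f g else 0 := by
  simp [interp_tensor_append, interp_wires]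

theorem interp_wires_tensor {n m k : ℕ} (D : Diagram n m) (f : Fin m → Fin 2)
    (f' g' : Fin k → Fin 2) (g : Fin n → Fin 2) :
    interp ((wires k).tensor D) (Fin.append f' f) (Fin.append g' g) =
      if f' = g' then interp D f g else 0 := by
  simp [interp_tensor_append, interp_wires]

theorem interp_interchange {n m k n' m' k' : ℕ} (A : Diagram n m) (B : Diagram m k)
    (A' : Diagram n' m') (B' : Diagram m' k') :
    interp (tensor (comp A B) (comp A' B')) = interp (comp (tensor A A') (tensor B B')) := by
  ext f g
  revert f g
  simp only [forall_append]
  intro f f' g g'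
  rw [interp_tensor_append, interp_comp_apply, interp_comp_apply, interp_comp_apply, sum_append,
    Finset.sum_mul_sum]
  simp only [interp_tensor_append]
  exact Finset.sum_congr rfl fun _ _ => Finset.sum_congr rfl fun _ _ => by ring

theorem interp_tensor_assoc {n m n' m' n'' m'' : ℕ} (A : Diagram n m) (B : Diagram n' m')
    (C : Diagram n'' m'') :
    interp (comp (tensor (tensor A B) C) (perm (finCongr (Nat.add_assoc m m' m'')))) =
      interp (comp (perm (finCongr (Nat.add_assoc n n' n''))) (tensor A (tensor B C))) := by
  ext f g
  revert f g
  simp only [forall_append]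
  intro f f' f'' g g' g''
  have h : Fin.append (Fin.append g g') g'' ∘ (finCongr (Nat.add_assoc n n' n'')).symm =
      Fin.append g (Fin.append g' g'') := by
    rw [← append_comp_finCongr_assoc]; ext i; simp
  rw [interp_comp_perm, interp_perm_comp, h, append_comp_finCongr_assoc]
  simp only [interp_tensor_append, mul_assoc]

theorem interp_empty_tensor {n m : ℕ} (A : Diagram n m) :
    interp (comp (tensor (wires 0) A) (perm (finCongr (Nat.zero_add m)))) =
      interp (comp (perm (finCongr (Nat.zero_add n))) A) := by
  ext f g
  revert g
  rw [forall_append]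
  intro g₀ g
  have h : Fin.append g₀ g ∘ (finCongr (Nat.zero_add n)).symm = g := by
    rw [Subsingleton.elim g₀ Fin.elim0, Fin.elim0_append]; ext i; simp
  have h' : f ∘ finCongr (Nat.zero_add m) = Fin.append g₀ f := by
    rw [Subsingleton.elim g₀ Fin.elim0, Fin.elim0_append]; rfl
  rw [interp_comp_perm, interp_perm_comp, h, h', interp_wires_tensor, if_pos rfl]

theorem interp_tensor_empty {n m : ℕ} (A : Diagram n m) :
    interp (tensor A (wires 0)) = interp A := by
  ext f g
  have h (k : ℕ) (x : Fin k → Fin 2) : x = Fin.append x (Fin.elim0 : Fin 0 → Fin 2) := by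
    rw [Fin.append_elim0]; rfl
  conv_lhs => rw [h m f, h n g]
  rw [interp_tensor_wires, if_pos rfl]

theorem interp_perm_tensor {n m k l : ℕ} (σ : Fin n ≃ Fin m) (τ : Fin k ≃ Fin l) :
    interp (tensor (perm σ) (perm τ)) =
      interp (perm ((finSumFinEquiv.symm.trans (σ.sumCongr τ)).trans finSumFinEquiv)) := by
  ext f g
  revert f g
  simp only [forall_append]
  intro f f' g g'
  rw [interp_tensor_append]
  simp only [interp, Matrix.of_apply, ite_zero_mul_ite_zero, mul_one]
  congr 1
  rw [← (finSumFinEquiv (m := n) (n := k)).forall_congr_right]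
  simp

theorem interp_swap_natural {n m k l : ℕ} (A : Diagram n m) (B : Diagram k l) :
    interp (comp (tensor A B) (perm finAddFlip)) =
      interp (comp (perm finAddFlip) (tensor B A)) := by
  have h (a b : ℕ) (x : Fin a → Fin 2) (y : Fin b → Fin 2) :
      Fin.append x y ∘ finAddFlip = Fin.append y x := by
    ext i; refine Fin.addCases (fun i => ?_) (fun i => ?_) i <;> simp
  ext f g
  revert f g
  simp only [forall_append]
  intro f f' g g'
  have h' : Fin.append g g' ∘ (finAddFlip : Fin (n + k) ≃ _).symm = Fin.append g' g := by
    rw [← h]; ext i; simp [finAddFlip]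
  rw [interp_comp_perm, interp_perm_comp, h, h', interp_tensor_append, interp_tensor_append,
    mul_comm]

theorem sum_fin_two_fun {M : Type*} [AddCommMonoid M] (F : (Fin 2 → Fin 2) → M) :
    ∑ h, F h = F ![0, 0] + F ![0, 1] + F ![1, 0] + F ![1, 1] := by
  rw [← (finTwoArrowEquiv (Fin 2)).symm.sum_comp, Fintype.sum_prod_type]
  simp [Fin.sum_univ_two, add_assoc]

theorem sum_fin_one_fun {M : Type*} [AddCommMonoid M] (F : (Fin 1 → Fin 2) → M) :
    ∑ h, F h = F ![0] + F ![1] := by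
  rw [← (Equiv.funUnique (Fin 1) (Fin 2)).symm.sum_comp, Fin.sum_univ_two]
  congr 2 <;> (ext i; fin_cases i; rfl)

theorem forall_fin_one_fun {p : (Fin 1 → Fin 2) → Prop} : (∀ h, p h) ↔ p ![0] ∧ p ![1] := by
  rw [← (Equiv.funUnique (Fin 1) (Fin 2)).symm.forall_congr_right, Fin.forall_fin_two]
  have h (a : Fin 2) : (Equiv.funUnique (Fin 1) (Fin 2)).symm a = ![a] := by
    ext i; fin_cases i; rfl
  rw [h, h]

theorem interp_snake :
    interp (comp (tensor cup (wires 1)) (tensor (wires 1) cap) : Diagram 1 1) =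
      interp (wires 1) := by
  have h : ∀ f g : Fin 1 → Fin 2,
      interp (comp (tensor cup (wires 1)) (tensor (wires 1) cap) : Diagram 1 1) f g =
        interp (wires 1) f g := by
    intro f g
    rw [interp_comp_apply]
    refine (sum_append (m := 1) (k := 2) _).trans ?_
    revert f g
    simp only [sum_fin_two_fun, sum_fin_one_fun, forall_fin_one_fun, interp_wires]
    simp +decide [interp, wires]
  ext f g; exact h f g

theorem interp_cup_swap :
    interp (comp cup (perm (Equiv.swap 0 1))) = interp cup := by
  ext f g
  rw [interp_comp_perm]
  simp [interp, eq_comm]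

theorem interp_spider_perm (c : Colour) (α : Real.Angle) (n m : ℕ) (σ : Equiv.Perm (Fin m)) :
    interp (comp (spider c α n m) (perm σ)) = interp (spider c α n m) := by
  ext f g
  simp only [interp_comp_perm, interp_spider, Function.comp_apply]
  simp only [fun b => Equiv.prod_comp σ (fun i => ket c b (f i))]

/-- Fusing spiders amounts to multiplying their coefficients in an orthonormal family; a single
connecting wire makes the family of products of kets orthonormal. -/
theorem sum_mul_of_orthonormal {X : Type*} [Fintype X] (K : Fin 2 → X → ℂ)
    (hK : ∀ a b, ∑ h, K a h * K b h = if a = b then 1 else 0) (u v : Fin 2 → ℂ) :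
    ∑ h, (∑ b, u b * K b h) * ∑ a, v a * K a h = ∑ b, u b * v b := by
  have e (h : X) : (∑ b, u b * K b h) * ∑ a, v a * K a h =
      u 0 * v 0 * (K 0 h * K 0 h) + u 0 * v 1 * (K 0 h * K 1 h) +
        u 1 * v 0 * (K 1 h * K 0 h) + u 1 * v 1 * (K 1 h * K 1 h) := by
    simp only [Fin.sum_univ_two]
    ring
  simp only [e, Finset.sum_add_distrib, ← Finset.mul_sum, hK]
  simp

theorem interp_spider_fusion (c : Colour) (α β : Real.Angle) (n m k l j : ℕ) :
    interp (comp (comp (tensor (spider c α n (m + (j + 1))) (wires k))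
            (perm (finCongr (Nat.add_assoc m (j + 1) k))))
          (tensor (wires m) (spider c β (j + 1 + k) l))) =
      interp (spider c (α + β) (n + k) (m + l)) := by
  have hp : j + 1 ≠ 0 := Nat.succ_ne_zero j
  generalize j + 1 = p at hp
  ext f g
  revert f g
  simp only [forall_append]
  intro f f' g g'
  rw [interp_comp_apply]
  simp only [sum_append, interp_comp_perm, append_comp_finCongr_assoc, interp_tensor_wires,
    interp_wires_tensor, ite_mul, zero_mul, mul_ite, mul_zero]
  simp only [Finset.sum_ite_irrel, Finset.sum_ite_eq, Finset.sum_ite_eq', Finset.mem_univ, if_true,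
    Finset.sum_const_zero, interp_spider, Fin.prod_univ_add, Fin.append_left, Fin.append_right]
  refine Eq.trans (Finset.sum_congr rfl fun h _ => ?_)
    ((sum_mul_of_orthonormal (fun b (h : Fin p → Fin 2) => ∏ i, ket c b (h i))
      (fun a b => by simp [sum_prod_ket_mul_prod_ket, hp])
      (fun b => phaseCoeff β b * ((∏ i, ket c b (f' i)) * ∏ i, ket c b (g' i)))
      (fun b => phaseCoeff α b * ((∏ i, ket c b (f i)) * ∏ i, ket c b (g i)))).trans ?_)
  · congr 1 <;> exact Finset.sum_congr rfl fun b _ => by ring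
  · refine Finset.sum_congr rfl fun b _ => ?_
    rw [phaseCoeff_add]
    ring

theorem interp_loop (c : Colour) (α : Real.Angle) (n m : ℕ) :
    interp (comp (spider c α n (m + 2)) (tensor (wires m) cap)) = interp (spider c α n m) := by
  have hcap (x : Fin 0 → Fin 2) (h : Fin 2 → Fin 2) :
      interp cap x h = if h 0 = h 1 then 1 else 0 := rfl
  ext f g
  have hf : f = Fin.append f (Fin.elim0 : Fin 0 → Fin 2) := by rw [Fin.append_elim0]; rfl
  rw [interp_comp_apply, sum_append]
  conv_lhs => rw [hf]
  simp only [interp_wires_tensor, ite_mul, zero_mul, Finset.sum_ite_irrel, Finset.sum_const_zero,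
    Finset.sum_ite_eq, Finset.mem_univ, if_true, hcap, sum_fin_two_fun, interp_spider,
    Fin.prod_univ_add, Fin.append_left, Fin.append_right, Fin.prod_univ_two]
  simp
  have h0 := sum_ket_mul_ket c 0 0
  have h1 := sum_ket_mul_ket c 1 1
  simp at h0 h1
  linear_combination (phaseCoeff α 0 * ((∏ i, ket c 0 (f i)) * ∏ j, ket c 0 (g j))) * h0 +
    (phaseCoeff α 1 * ((∏ i, ket c 1 (f i)) * ∏ j, ket c 1 (g j))) * h1

theorem interp_cup_rule (c : Colour) : interp (spider c 0 0 2) = interp cup := by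
  ext f g
  simp only [interp_spider, phaseCoeff_zero, Fin.prod_univ_two, Finset.univ_eq_empty,
    Finset.prod_empty, mul_one, one_mul, sum_ket_mul_ket']
  rfl

theorem sum_ket_red_mul_ket (c : Colour) (b x : Fin 2) :
    ∑ y, ket .red y x * ket c b y = ket c.other b x := by
  have h2 : (Real.sqrt 2 : ℂ) * Real.sqrt 2 = 2 := by
    rw [← Complex.ofReal_mul]; norm_num
  cases c <;> fin_cases b <;> fin_cases x <;>
    (simp [ket, Colour.other, ← mul_inv, h2]; try norm_num)

theorem ket_red_comm (x y : Fin 2) : ket .red x y = ket .red y x := by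
  simp only [ket, and_comm]

theorem interp_hadamards_mul_spider (c : Colour) (α : Real.Angle) (n m : ℕ) :
    interp (comp (comp (hadamards n) (spider c α n m)) (hadamards m)) =
      interp (spider c.other α n m) := by
  ext f g
  have h (f : Fin m → Fin 2) (g : Fin n → Fin 2) :
      interp (comp (hadamards n) (spider c α n m)) f g =
        ∑ b, phaseCoeff α b * ((∏ i, ket c b (f i)) * ∏ j, ket c.other b (g j)) := by
    simp only [interp_comp_apply, interp_hadamards, ket_red_comm (g _)]
    rw [sum_interp_spider_mul_prod (fun x y => ket .red x y)]
    simp only [mul_comm (ket c _ _), sum_ket_red_mul_ket]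
  rw [interp_comp_apply]
  simp only [interp_hadamards, h, interp_spider]
  rw [sum_prod_mul_sum_ket (fun x y => ket .red y x)]
  simp only [sum_ket_red_mul_ket]

theorem sum_interp_phase_pi_mul_ket (c : Colour) (b : Fin 2) (y : Fin 2) :
    ∑ x, interp (phase c.other (Real.pi : ℝ)) (fun _ => y) (fun _ => x) * ket c b x =
      ket c (b + 1) y := by
  have h2 : (Real.sqrt 2 : ℂ) * Real.sqrt 2 = 2 := by
    rw [← Complex.ofReal_mul]; norm_num
  cases c <;> fin_cases b <;> fin_cases y <;>
    (simp [ket, Colour.other, phase, interp_spider, phaseCoeff, ← mul_inv, h2]; try norm_num)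

theorem interp_phase_comm (c : Colour) (α : Real.Angle) (f g : Fin 1 → Fin 2) :
    interp (phase c α) f g = interp (phase c α) g f :=
  congrFun (congrFun (interp_flip (phase c α)) f) g

theorem interp_pi_copy (c : Colour) (m : ℕ) :
    interp (comp (phase c.other (Real.pi : ℝ)) (spider c 0 1 m)) =
      interp (comp (spider c 0 1 m) (phases c.other (Real.pi : ℝ) m)) := by
  ext f g
  have hX (h : Fin 1 → Fin 2) : interp (phase c.other (Real.pi : ℝ)) h g =
      ∏ j, interp (phase c.other (Real.pi : ℝ)) (fun _ => h j) (fun _ => g j) := by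
    rw [Fin.prod_univ_one]
    congr 1 <;> (ext i; fin_cases i; rfl)
  have hL : interp (comp (phase c.other (Real.pi : ℝ)) (spider c 0 1 m)) f g =
      ∑ b, phaseCoeff 0 b * ((∏ i, ket c b (f i)) * ∏ j, ket c (b + 1) (g j)) := by
    simp only [interp_comp_apply, hX]
    rw [sum_interp_spider_mul_prod
      (fun x y => interp (phase c.other (Real.pi : ℝ)) (fun _ => x) (fun _ => y))]
    simp only [fun (z : Fin 2) (x : Fin 1) => interp_phase_comm c.other (Real.pi : ℝ) (fun _ => z)
      (fun _ => g x), mul_comm (ket c _ _), sum_interp_phase_pi_mul_ket]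
  have hR : interp (comp (spider c 0 1 m) (phases c.other (Real.pi : ℝ) m)) f g =
      ∑ b, phaseCoeff 0 b * ((∏ i, ket c (b + 1) (f i)) * ∏ j, ket c b (g j)) := by
    simp only [interp_comp_apply, interp_phases, interp_spider]
    rw [sum_prod_mul_sum_ket
      (fun x y => interp (phase c.other (Real.pi : ℝ)) (fun _ => x) (fun _ => y))]
    simp only [sum_interp_phase_pi_mul_ket]
  rw [hL, hR]
  simp [Fin.sum_univ_two, phaseCoeff_zero, add_comm]

theorem interp_innerprod_zero_ne_zero (c : Colour) :
    interp (innerprod c 0 c.other 0) 0 0 ≠ 0 := by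
  cases c <;> simp [innerprod, state, effect, interp_comp_apply, interp_spider, sum_fin_one_fun,
    phaseCoeff, ket, Colour.other]

theorem interp_innerprod_pi_ne_zero (c : Colour) (α : Real.Angle) :
    interp (innerprod c α c.other (Real.pi : ℝ)) 0 0 ≠ 0 := by
  cases c with
  | green =>
    simp [innerprod, state, effect, interp_comp_apply, interp_spider, sum_fin_one_fun,
      phaseCoeff, ket, Colour.other]
  | red =>
    have h : interp (innerprod .red α Colour.red.other (Real.pi : ℝ)) 0 0 =
        2 * α.toCircle * (Real.sqrt 2 : ℂ)⁻¹ := by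
      simp [innerprod, state, effect, interp_comp_apply, interp_spider, sum_fin_one_fun,
        phaseCoeff, ket, Colour.other]
      ring
    rw [h]
    simp

theorem interp_innerprod_neg_pi_div_two_ne_zero (c : Colour) :
    interp (innerprod c (-(Real.pi / 2) : ℝ) c.other (-(Real.pi / 2) : ℝ)) 0 0 ≠ 0 := by
  have h : interp (innerprod c (-(Real.pi / 2) : ℝ) c.other (-(Real.pi / 2) : ℝ)) 0 0 =
      2 * (1 - Complex.I) * (Real.sqrt 2 : ℂ)⁻¹ := by
    cases c <;> simp [innerprod, state, effect, interp_comp_apply, interp_spider, sum_fin_one_fun,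
      phaseCoeff, ket, Colour.other] <;>
      linear_combination (-(Real.sqrt 2 : ℂ)⁻¹) * Complex.I_sq
  have hI : (1 : ℂ) - Complex.I ≠ 0 := fun h => by simpa using congrArg Complex.re h
  rw [h]
  simp [hI]

theorem interp_copy (c : Colour) :
    EqUpToScalar (interp (comp (state c.other 0) (spider c 0 1 2)))
      (interp (tensor (state c.other 0) (state c.other 0))) := by
  have h2 : (Real.sqrt 2 : ℂ)⁻¹ * (Real.sqrt 2 : ℂ)⁻¹ = 1 / 2 := by
    rw [← mul_inv, ← Complex.ofReal_mul]; norm_num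
  refine ⟨1 / (Real.sqrt 2 : ℂ), by simp, ?_⟩
  ext f g
  revert f
  simp only [forall_append (m := 1) (k := 1), forall_fin_one_fun]
  cases c <;> simp +decide [state, interp, Matrix.mul_apply, ket, Colour.other, sum_fin_one_fun] <;>
    grind

theorem interp_bialgebra_green :
    EqUpToScalar (interp (comp (comp (tensor (spider .green 0 1 2) (spider .green 0 1 2))
            (perm (Equiv.swap (1 : Fin 4) 2)))
          (tensor (spider .red 0 2 1) (spider .red 0 2 1))))
      (interp (comp (spider .red 0 2 1) (spider .green 0 1 2))) := by
  have h2 : (Real.sqrt 2 : ℂ)⁻¹ * (Real.sqrt 2 : ℂ)⁻¹ = 1 / 2 := by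
    rw [← mul_inv, ← Complex.ofReal_mul]; norm_num
  refine ⟨1 / (Real.sqrt 2 : ℂ), by simp, ?_⟩
  ext f g
  rw [interp_comp_apply, Matrix.smul_apply]
  simp only [interp_comp_perm]
  rw [sum_append (m := 2) (k := 2)]
  revert f g
  simp only [forall_append (m := 1) (k := 1), forall_fin_one_fun, interp_comp_apply,
    sum_fin_one_fun, sum_fin_two_fun]
  simp +decide [interp_tensor, interp_spider, phaseCoeff, ket]
  grind

theorem interp_pi_commutation (c : Colour) (α : Real.Angle) :
    EqUpToScalar (interp (comp (phase c α) (phase c.other (Real.pi : ℝ))))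
      (interp (comp (phase c.other (Real.pi : ℝ)) (phase c (-α)))) := by
  have h2 : (Real.sqrt 2 : ℂ)⁻¹ * (Real.sqrt 2 : ℂ)⁻¹ = 1 / 2 := by
    rw [← mul_inv, ← Complex.ofReal_mul]; norm_num
  have h3 : (α.toCircle : ℂ) * (α.toCircle : ℂ)⁻¹ = 1 := by simp
  refine ⟨α.toCircle, by simp, ?_⟩
  ext f g
  revert f g
  simp only [forall_fin_one_fun]
  cases c <;> simp [phase, interp_comp_apply, interp_spider, sum_fin_one_fun,
      phaseCoeff, ket, Colour.other] <;> grind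

theorem interp_euler (c : Colour) :
    EqUpToScalar (interp hadamard)
      (interp (comp (comp (phase c (Real.pi / 2 : ℝ)) (phase c.other (Real.pi / 2 : ℝ)))
            (phase c (Real.pi / 2 : ℝ)))) := by
  have h2 : (Real.sqrt 2 : ℂ)⁻¹ * (Real.sqrt 2 : ℂ)⁻¹ = 1 / 2 := by
    rw [← mul_inv, ← Complex.ofReal_mul]; norm_num
  have h3 := Complex.I_sq
  have hI : (1 : ℂ) - Complex.I ≠ 0 := fun h => by simpa using congrArg Complex.re h
  -- The scalar is `exp (-i π / 4)`.
  refine ⟨(1 - Complex.I) * (Real.sqrt 2 : ℂ)⁻¹, by simp [hI], ?_⟩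
  ext f g
  revert f g
  simp only [forall_fin_one_fun]
  cases c <;> simp [phase, interp_comp_apply, sum_fin_one_fun, interp_spider,
      phaseCoeff, ket, Colour.other, interp_hadamard] <;> grind

end Soundness

open Diagram

theorem interp_spider_pi_zero (c : Colour) (f g : Fin 0 → Fin 2) :
    interp (spider c (Real.pi : ℝ) 0 0) f g = 0 := by
  simp [interp_spider, phaseCoeff]

/-- Every rule is sound up to a non-zero scalar. -/
theorem Rule.eqUpToScalar {n m : ℕ} {D E : Diagram n m} (h : Rule D E) :
    EqUpToScalar (interp D) (interp E) := by
  cases h with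
  | comp_assoc A B C => exact .of_eq (by simp only [interp_comp, Matrix.mul_assoc])
  | wires_comp A =>
    refine .of_eq ?_
    ext f g
    simp [interp_comp_apply, interp_wires]
  | comp_wires A =>
    refine .of_eq ?_
    ext f g
    simp [interp_comp_apply, interp_wires]
  | interchange A B A' B' => exact .of_eq (interp_interchange A B A' B')
  | tensor_assoc A B C => exact .of_eq (interp_tensor_assoc A B C)
  | tensor_empty A => exact .of_eq (interp_tensor_empty A)
  | empty_tensor A => exact .of_eq (interp_empty_tensor A)
  | perm_comp σ τ =>
    refine .of_eq ?_
    ext f g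
    rw [interp_comp_perm, interp_perm, interp_perm]
    rfl
  | perm_tensor σ τ => exact .of_eq (interp_perm_tensor σ τ)
  | swap_natural A B => exact .of_eq (interp_swap_natural A B)
  | snake => exact .of_eq interp_snake
  | cup_swap => exact .of_eq interp_cup_swap
  | spider_perm c α n m σ => exact .of_eq (interp_spider_perm c α n m σ)
  | spider c α β n m k l j => exact .of_eq (interp_spider_fusion c α β n m k l j)
  | loop c α n m => exact .of_eq (interp_loop c α n m)
  | cup_rule c => exact .of_eq (interp_cup_rule c)
  | bialgebra c =>
    refine (eqUpToScalar_scale _ _ (interp_innerprod_zero_ne_zero c)).trans ?_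
    cases c with
    | green => exact interp_bialgebra_green
    | red =>
      -- Up to associativity, the red rule is the green one upside-down.
      have h := interp_bialgebra_green.transpose
      rw [← interp_flip, ← interp_flip] at h
      refine (EqUpToScalar.of_eq ?_).trans h
      simp only [interp_comp, Matrix.mul_assoc, Diagram.flip, Equiv.symm_swap]
      rfl
  | copy c => exact (eqUpToScalar_scale _ _ (interp_innerprod_zero_ne_zero c)).trans (interp_copy c)
  | pi_copy c m => exact .of_eq (interp_pi_copy c m)
  | pi_commutation c α =>
    exact (eqUpToScalar_scale _ _ (interp_innerprod_zero_ne_zero c)).trans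
      ((interp_pi_commutation c α).trans
        (eqUpToScalar_scale _ _ (interp_innerprod_pi_ne_zero c α)).symm)
  | colour_change c α n m => exact .of_eq (interp_hadamards_mul_spider c α n m)
  | euler c =>
    exact (eqUpToScalar_scale _ _ (interp_innerprod_zero_ne_zero c)).trans
      ((eqUpToScalar_scale _ _ (interp_innerprod_zero_ne_zero c)).trans
        ((interp_euler c).trans
          (eqUpToScalar_scale _ _ (interp_innerprod_neg_pi_div_two_ne_zero c)).symm))
  | zero c => exact .of_eq (by simp only [interp_scale, interp_spider_pi_zero, zero_smul])
  | zero_scalar c α =>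
    refine .of_eq ?_
    ext f g
    exact (mul_eq_zero_of_left (interp_spider_pi_zero c _ _) _).trans
      (interp_spider_pi_zero c f g).symm
  | scalar_zero c =>
    exact ⟨_, interp_innerprod_zero_ne_zero c, by
      ext f g; simp [interp_wires, Subsingleton.elim f 0, Subsingleton.elim g 0]⟩
  | scalar_pi c k =>
    exact ⟨_, interp_innerprod_pi_ne_zero c (k * (Real.pi / 4) : ℝ), by
      ext f g; simp [interp_wires, Subsingleton.elim f 0, Subsingleton.elim g 0]⟩
  | scalar_pi_div_two c =>
    exact ⟨_, interp_innerprod_neg_pi_div_two_ne_zero c, by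
      ext f g; simp [interp_wires, Subsingleton.elim f 0, Subsingleton.elim g 0]⟩

/-- The calculus is sound: derivable equalities hold up to a non-zero scalar. -/
theorem Derivable.eqUpToScalar {P : Set Real.Angle} {n m : ℕ} {D E : Diagram n m}
    (h : Derivable P D E) : EqUpToScalar (interp D) (interp E) := by
  induction h with
  | rule h _ _ => exact h.eqUpToScalar
  | rule_flip h _ _ => rw [interp_flip, interp_flip]; exact h.eqUpToScalar.transpose
  | refl D => exact .of_eq rfl
  | symm _ ih => exact ih.symm
  | trans _ _ ih ih' => exact ih.trans ih'
  | comp _ _ ih ih' => exact ih'.mul ih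
  | tensor _ _ ih ih' => exact ih.tensor ih'

/-! ### Derived rewrites of phase shifts and Hadamard nodes -/

section Derivations

variable {P : Set Real.Angle}

theorem perm_eq_wires {n : ℕ} (σ : Fin n ≃ Fin n) (h : ∀ i, σ i = i) : perm σ = wires n := by
  rw [wires, Equiv.ext (f := σ) (g := Equiv.refl _) h]

theorem derivable_comp_perm {n m : ℕ} (A : Diagram n m) (hA : A.PhasesIn P) (σ : Fin m ≃ Fin m)
    (h : ∀ i, σ i = i) : Derivable P (comp A (perm σ)) A := by
  rw [perm_eq_wires σ h]
  exact .rule (.comp_wires A) ⟨hA, trivial⟩ hA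

theorem derivable_perm_comp {n m : ℕ} (A : Diagram n m) (hA : A.PhasesIn P) (σ : Fin n ≃ Fin n)
    (h : ∀ i, σ i = i) : Derivable P (comp (perm σ) A) A := by
  rw [perm_eq_wires σ h]
  exact .rule (.wires_comp A) ⟨trivial, hA⟩ hA

theorem derivable_empty_tensor (A : Diagram 1 1) (hA : A.PhasesIn P) :
    Derivable P (tensor (wires 0) A) A := by
  have h : Derivable P (comp (tensor (wires 0) A) (perm (finCongr (Nat.zero_add 1))))
      (comp (perm (finCongr (Nat.zero_add 1))) A) :=
    .rule (.empty_tensor A) ⟨⟨trivial, hA⟩, trivial⟩ ⟨trivial, hA⟩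
  exact (derivable_comp_perm (tensor (wires 0) A) ⟨trivial, hA⟩ _ (fun i => rfl)).symm.trans
    (h.trans (derivable_perm_comp A hA _ (fun i => rfl)))

theorem derivable_phase_comp_phase (c : Colour) {α β : Real.Angle} (hα : α ∈ P) (hβ : β ∈ P)
    (hαβ : α + β ∈ P) :
    Derivable P (comp (phase c α) (phase c β)) (phase c (α + β)) := by
  have h : Derivable P
      (comp (comp (tensor (phase c α) (wires 0)) (perm (finCongr (Nat.add_assoc 0 (0 + 1) 0))))
        (tensor (wires 0) (phase c β)))
      (phase c (α + β)) :=
    .rule (.spider c α β 1 0 0 1 0) ⟨⟨⟨hα, trivial⟩, trivial⟩, ⟨trivial, hβ⟩⟩ hαβ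
  refine Derivable.trans (.comp ?_ ?_) h
  · exact .symm (.trans (derivable_comp_perm (tensor (phase c α) (wires 0)) ⟨hα, trivial⟩ _
      (fun i => rfl)) (.rule (.tensor_empty (phase c α)) ⟨hα, trivial⟩ hα))
  · exact (derivable_empty_tensor (phase c β) hβ).symm

/-- A phase shift by zero is a wire: by the spider rule it is a yanked pair of bent wires. -/
theorem derivable_phase_zero (c : Colour) (h0 : (0 : Real.Angle) ∈ P) :
    Derivable P (phase c 0) (wires 1) := by
  have h : Derivable P
      (comp (comp (tensor (spider c 0 0 2) (wires 1)) (perm (finCongr (Nat.add_assoc 1 1 1))))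
        (tensor (wires 1) (spider c 0 2 0)))
      (phase c (0 + 0)) :=
    .rule (.spider c 0 0 0 1 1 0 0) ⟨⟨⟨h0, trivial⟩, trivial⟩, ⟨trivial, h0⟩⟩
      (by simpa [phase, PhasesIn] using h0)
  rw [show (0 : Real.Angle) + 0 = 0 from add_zero 0] at h
  refine h.symm.trans (Derivable.trans (.comp ?_ ?_)
    (.rule .snake ⟨⟨trivial, trivial⟩, trivial, trivial⟩ trivial))
  · exact (derivable_comp_perm (tensor (spider c 0 0 2) (wires 1)) ⟨h0, trivial⟩ _
      (fun i => rfl)).trans (.tensor (.rule (.cup_rule c) h0 trivial) (.refl _))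
  · exact .tensor (.refl _) (.rule_flip (.cup_rule c) h0 trivial)

theorem derivable_hadamards_one : Derivable P (hadamards 1) hadamard :=
  derivable_empty_tensor hadamard trivial

theorem derivable_hadamard_phase_hadamard (c : Colour) {α : Real.Angle} (hα : α ∈ P) :
    Derivable P (comp (comp hadamard (phase c α)) hadamard) (phase c.other α) := by
  have hH : (hadamards 1).PhasesIn P := ⟨trivial, trivial⟩
  have h : Derivable P (comp (comp (hadamards 1) (phase c α)) (hadamards 1)) (phase c.other α) :=
    .rule (.colour_change c α 1 1) ⟨⟨hH, hα⟩, hH⟩ hα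
  exact .trans (.comp (.comp derivable_hadamards_one.symm (.refl _)) derivable_hadamards_one.symm) h

theorem derivable_scale {n m : ℕ} (D : Diagram n m) (hD : D.PhasesIn P) {s : Diagram 0 0}
    (hs : Derivable P s (wires 0)) : Derivable P (D.scale s) D :=
  .trans (.tensor (.refl D) hs) (.rule (.tensor_empty D) ⟨hD, trivial⟩ hD)

theorem derivable_pi_commutation (c : Colour) (k : ℤ) (h0 : (0 : Real.Angle) ∈ P)
    (hpi : ((Real.pi : ℝ) : Real.Angle) ∈ P) (hk : ((k * (Real.pi / 4) : ℝ) : Real.Angle) ∈ P)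
    (hk' : -((k * (Real.pi / 4) : ℝ) : Real.Angle) ∈ P) :
    Derivable P (comp (phase c (k * (Real.pi / 4) : ℝ)) (phase c.other (Real.pi : ℝ)))
      (comp (phase c.other (Real.pi : ℝ)) (phase c (-(k * (Real.pi / 4) : ℝ)))) :=
  .trans (.symm (derivable_scale
      (comp (phase c (k * (Real.pi / 4) : ℝ)) (phase c.other (Real.pi : ℝ))) (by exact ⟨hk, hpi⟩)
      (.rule (.scalar_zero c) ⟨h0, h0⟩ trivial)))
    (.trans (.rule (.pi_commutation c _) ⟨⟨hk, hpi⟩, h0, h0⟩ ⟨⟨hpi, hk'⟩, hk, hpi⟩)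
      (derivable_scale (comp (phase c.other (Real.pi : ℝ)) (phase c (-(k * (Real.pi / 4) : ℝ))))
        (by exact ⟨hpi, hk'⟩)
        (.rule (.scalar_pi c k) ⟨hk, hpi⟩ trivial)))

theorem derivable_euler (c : Colour) (h0 : (0 : Real.Angle) ∈ P)
    (h2 : ((Real.pi / 2 : ℝ) : Real.Angle) ∈ P) (h2' : ((-(Real.pi / 2) : ℝ) : Real.Angle) ∈ P) :
    Derivable P hadamard
      (comp (comp (phase c (Real.pi / 2 : ℝ)) (phase c.other (Real.pi / 2 : ℝ)))
        (phase c (Real.pi / 2 : ℝ))) := by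
  have hs : Derivable P (innerprod c 0 c.other 0) (wires 0) :=
    .rule (.scalar_zero c) ⟨h0, h0⟩ trivial
  have hH : Derivable P (scale (scale hadamard (innerprod c 0 c.other 0)) (innerprod c 0 c.other 0))
      hadamard :=
    .trans (.tensor (derivable_scale hadamard trivial hs) (.refl _))
      (derivable_scale (P := P) hadamard trivial hs)
  exact hH.symm.trans (.trans (.rule (.euler c) ⟨⟨trivial, h0, h0⟩, h0, h0⟩
      ⟨⟨⟨h2, h2⟩, h2⟩, h2', h2'⟩)
      (derivable_scale (comp (comp (phase c (Real.pi / 2 : ℝ)) (phase c.other (Real.pi / 2 : ℝ)))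
        (phase c (Real.pi / 2 : ℝ))) (by exact ⟨⟨h2, h2⟩, h2⟩)
        (.rule (.scalar_pi_div_two c) ⟨h2', h2'⟩ trivial)))

end Derivations

/-! ### The monoid of single-qubit diagrams -/

section LineMonoid

variable (P : AddSubgroup Real.Angle)

/-- Derivability on the one-qubit diagrams with phases in `P`. -/
def derivableSetoid : Setoid {D : Diagram 1 1 // D.PhasesIn (P : Set Real.Angle)} where
  r D E := Derivable (P : Set Real.Angle) D.1 E.1
  iseqv := ⟨fun D => .refl D.1, fun h => h.symm, fun h h' => h.trans h'⟩

/-- One-qubit diagrams with phases in `P`, modulo derivability. They form a monoid whose product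
is composition of operators: in `x * y` the diagram `y` is at the bottom. -/
def LineMonoid : Type := Quotient (derivableSetoid P)

variable {P}

/-- The class of a one-qubit diagram. -/
def LineMonoid.mk (D : Diagram 1 1) (hD : D.PhasesIn (P : Set Real.Angle)) : LineMonoid P :=
  Quotient.mk (derivableSetoid P) ⟨D, hD⟩

theorem LineMonoid.mk_eq_mk {D E : Diagram 1 1} {hD : D.PhasesIn (P : Set Real.Angle)}
    {hE : E.PhasesIn (P : Set Real.Angle)} :
    LineMonoid.mk D hD = LineMonoid.mk E hE ↔ Derivable (P : Set Real.Angle) D E :=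
  Quotient.eq (r := derivableSetoid P)

instance : Monoid (LineMonoid P) where
  mul := Quotient.map₂ (fun D E => ⟨E.1.comp D.1, E.2, D.2⟩) fun _ _ h _ _ h' => .comp h' h
  one := .mk (wires 1) trivial
  mul_assoc := by
    rintro ⟨D, hD⟩ ⟨E, hE⟩ ⟨F, hF⟩
    exact LineMonoid.mk_eq_mk.2
      (Derivable.rule (.comp_assoc F E D) ⟨⟨hF, hE⟩, hD⟩ ⟨hF, hE, hD⟩).symm
  one_mul := by
    rintro ⟨D, hD⟩
    exact LineMonoid.mk_eq_mk.2 (.rule (.comp_wires D) ⟨hD, trivial⟩ hD)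
  mul_one := by
    rintro ⟨D, hD⟩
    exact LineMonoid.mk_eq_mk.2 (.rule (.wires_comp D) ⟨trivial, hD⟩ hD)

end LineMonoid

/-! ### Relations between the gates -/

/-- Relations between the phase shifts `T` and `R` (green `π / 4` and red `π / 2`) that suffice to
bring every product of them into normal form: their orders, the commutation of each with the
`π` shift of the other colour, and the equality of the two Euler decompositions of a Hadamard
node. -/
structure CliffordTRelations {M : Type*} [Monoid M] (T R : M) : Prop where
  T_pow_eight : T ^ 8 = 1
  R_pow_four : R ^ 4 = 1
  R_sq_mul_T : R ^ 2 * T = T ^ 7 * R ^ 2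
  T_pow_four_mul_R : T ^ 4 * R = R ^ 3 * T ^ 4
  euler : T ^ 2 * R * T ^ 2 = R * T ^ 2 * R

section Gates

variable {P : AddSubgroup Real.Angle} (hP : ((Real.pi / 4 : ℝ) : Real.Angle) ∈ P)

include hP in
theorem int_mul_pi_div_four_mem (k : ℤ) : ((k * (Real.pi / 4) : ℝ) : Real.Angle) ∈ P := by
  rw [← zsmul_eq_mul, Real.Angle.coe_zsmul]
  exact P.zsmul_mem hP k

theorem phasesIn_phase {c : Colour} {α : Real.Angle} (h : α ∈ P) :
    (phase c α).PhasesIn (P : Set Real.Angle) := by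
  simpa [phase, PhasesIn] using h

/-- The class of the phase shift by `k * π / 4`. -/
noncomputable def gate (c : Colour) (k : ℤ) : LineMonoid P :=
  .mk (phase c (k * (Real.pi / 4) : ℝ)) (phasesIn_phase (int_mul_pi_div_four_mem hP k))

/-- The class of the Hadamard node. -/
def had (P : AddSubgroup Real.Angle) : LineMonoid P := .mk hadamard trivial

theorem mk_phase (c : Colour) (α : Real.Angle) (k : ℤ) (hα : α ∈ P)
    (h : α = ((k * (Real.pi / 4) : ℝ) : Real.Angle)) :
    LineMonoid.mk (phase c α) (phasesIn_phase hα) = gate hP c k := by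
  subst h; rfl

theorem gate_mul_gate (c : Colour) (j k : ℤ) : gate hP c j * gate hP c k = gate hP c (j + k) := by
  have h : ((k * (Real.pi / 4) : ℝ) : Real.Angle) + ((j * (Real.pi / 4) : ℝ) : Real.Angle) =
      (((j + k : ℤ) * (Real.pi / 4) : ℝ) : Real.Angle) := by
    rw [← Real.Angle.coe_add]; push_cast; congr 1; ring
  refine LineMonoid.mk_eq_mk.2 ?_
  rw [← h]
  exact derivable_phase_comp_phase c (int_mul_pi_div_four_mem hP k)
    (int_mul_pi_div_four_mem hP j)
    (P.add_mem (int_mul_pi_div_four_mem hP k) (int_mul_pi_div_four_mem hP j))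

theorem gate_zero (c : Colour) : gate hP c 0 = 1 := by
  refine LineMonoid.mk_eq_mk.2 ?_
  have h := derivable_phase_zero (P := (P : Set Real.Angle)) c P.zero_mem
  simpa using h

theorem gate_eight_mul (c : Colour) (k : ℤ) : gate hP c (8 * k) = 1 := by
  rw [← gate_zero hP c]
  refine mk_phase hP c _ 0 (int_mul_pi_div_four_mem hP (8 * k)) ?_
  have : (((8 * k : ℤ) * (Real.pi / 4) : ℝ)) = k * (2 * Real.pi) := by push_cast; ring
  rw [this, ← zsmul_eq_mul, Real.Angle.coe_zsmul, Real.Angle.coe_two_pi]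
  simp

theorem gate_add_eight (c : Colour) (k : ℤ) : gate hP c (k + 8) = gate hP c k := by
  rw [← gate_mul_gate, show (8 : ℤ) = 8 * 1 from rfl, gate_eight_mul, mul_one]

theorem gate_natCast_mul (c : Colour) (n : ℕ) (j : ℤ) : gate hP c (n * j) = gate hP c j ^ n := by
  induction n with
  | zero => simpa using gate_zero hP c
  | succ n ih => rw [pow_succ, ← ih, gate_mul_gate]; push_cast; congr 1; ring

theorem gate_natCast (c : Colour) (n : ℕ) : gate hP c n = gate hP c 1 ^ n := by
  rw [← gate_natCast_mul, mul_one]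

theorem had_mul_gate_mul_had (c : Colour) (k : ℤ) :
    had P * gate hP c k * had P = gate hP c.other k := by
  rw [mul_assoc]
  exact LineMonoid.mk_eq_mk.2
    (derivable_hadamard_phase_hadamard c (int_mul_pi_div_four_mem hP k))

/-- A phase shift by `π` passes a phase shift of the other colour, negating it. -/
theorem gate_four_mul_gate (c : Colour) (k : ℤ) :
    gate hP c.other 4 * gate hP c k = gate hP c (-k) * gate hP c.other 4 := by
  have hpi : ((Real.pi : ℝ) : Real.Angle) ∈ P := by
    have := int_mul_pi_div_four_mem hP 4
    rwa [show (((4 : ℤ) : ℝ) * (Real.pi / 4)) = Real.pi by push_cast; ring] at this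
  have h := derivable_pi_commutation (P := (P : Set Real.Angle)) c k P.zero_mem hpi
    (int_mul_pi_div_four_mem hP k) (P.neg_mem (int_mul_pi_div_four_mem hP k))
  refine LineMonoid.mk_eq_mk.2 ?_
  change Derivable (P : Set Real.Angle)
    (comp (phase c (k * (Real.pi / 4) : ℝ)) (phase c.other ((4 : ℤ) * (Real.pi / 4) : ℝ)))
    (comp (phase c.other ((4 : ℤ) * (Real.pi / 4) : ℝ)) (phase c ((-k : ℤ) * (Real.pi / 4) : ℝ)))
  rw [show (((4 : ℤ) : ℝ) * (Real.pi / 4)) = Real.pi by push_cast; ring, Int.cast_neg, neg_mul,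
    Real.Angle.coe_neg]
  exact h

/-- The Euler decomposition of the Hadamard node. -/
theorem had_eq (c : Colour) : had P = gate hP c 2 * gate hP c.other 2 * gate hP c 2 := by
  have e : (((2 : ℤ) : ℝ) * (Real.pi / 4)) = Real.pi / 2 := by push_cast; ring
  have e' : (((-2 : ℤ) : ℝ) * (Real.pi / 4)) = -(Real.pi / 2) := by push_cast; ring
  have h2 := int_mul_pi_div_four_mem hP 2
  have h2' := int_mul_pi_div_four_mem hP (-2)
  rw [e] at h2
  rw [e'] at h2'
  have h := derivable_euler (P := (P : Set Real.Angle)) c P.zero_mem h2 h2'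
  rw [mul_assoc]
  refine LineMonoid.mk_eq_mk.2 ?_
  rw [← e] at h
  exact h

theorem cliffordTRelations : CliffordTRelations (gate hP .green 1) (gate hP .red 2) := by
  have hR : gate hP .red 2 = gate hP .red 1 ^ 2 := gate_natCast hP .red 2
  have h4 (c : Colour) : gate hP c 4 = gate hP c 1 ^ 4 := gate_natCast hP c 4
  have h8 (c : Colour) : gate hP c 1 ^ 8 = 1 :=
    (gate_natCast hP c 8).symm.trans (gate_eight_mul hP c 1)
  refine ⟨h8 _, ?_, ?_, ?_, ?_⟩
  · rw [hR, ← pow_mul, h8]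
  · have h := gate_four_mul_gate hP .green 1
    rw [← gate_add_eight hP .green (-1)] at h
    rw [hR, ← pow_mul]
    rw [h4, show (-1 + 8 : ℤ) = ((7 : ℕ) : ℤ) by norm_num, gate_natCast] at h
    exact h
  · have h := gate_four_mul_gate hP .red 2
    rw [← gate_add_eight hP .red (-2), show (-2 + 8 : ℤ) = ((6 : ℕ) : ℤ) by norm_num,
      gate_natCast] at h
    rw [show (6 : ℕ) = 2 * 3 by norm_num, pow_mul, ← hR] at h
    simpa [Colour.other, h4] using h
  · have h := (had_eq hP .green).symm.trans (had_eq hP .red)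
    have hS : gate hP .green 2 = gate hP .green 1 ^ 2 := gate_natCast hP .green 2
    simpa only [Colour.other, hS] using h

include hP in
/-- Every Clifford+T line diagram has its phases in `P`. -/
theorem IsLine.phasesIn {D : Diagram 1 1} (h : IsLine (Real.pi / 4) D) :
    D.PhasesIn (P : Set Real.Angle) := by
  induction h with
  | wire => trivial
  | hadamard => trivial
  | phase c k => exact phasesIn_phase (int_mul_pi_div_four_mem hP k)
  | comp _ _ h h' => exact ⟨h, h'⟩

theorem gate_mul_mem (c : Colour) (k j : ℤ) (N : Submonoid (LineMonoid P))
    (h : gate hP c j ∈ N) : gate hP c (k * j) ∈ N := by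
  -- As `8` shifts by `π / 4` are a full turn, `k` may be replaced by a natural number.
  obtain ⟨n, hn⟩ : ∃ n : ℕ, (n : ℤ) = k + 8 * |k| :=
    ⟨(k + 8 * |k|).toNat, Int.toNat_of_nonneg (by rcases abs_cases k with h | h <;> omega)⟩
  have : gate hP c (n * j) = gate hP c (k * j) := by
    rw [hn, add_mul, mul_assoc 8, ← gate_mul_gate, gate_eight_mul, mul_one]
  rw [← this, gate_natCast_mul]
  exact N.pow_mem h n

end Gates

/-! ### Existence of normal forms -/

section Existence

variable {M : Type*} [Monoid M]

/-- The element of `𝒲` given by `T` and `R`. -/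
def WGate.val (T R : M) : WGate → M
  | .I => 1
  | .R => R
  | .SR => T ^ 2 * R

/-- The element of `𝒱` given by `T` and `R`. -/
def VGate.val (T R : M) : VGate → M
  | .TR => T * R
  | .TSR => T ^ 3 * R

/-- The Clifford operator `C` in the element `TC` of `𝒰`. Here `S^a` is written as `T ^ (2 * a)`
and `S⁻¹` as `T ^ 6`. -/
def UGate.clifford (T R : M) : UGate → M
  | .short a b => T ^ (2 * (a : ℕ)) * R ^ (b : ℕ)
  | .long a sign => T ^ (2 * (a : ℕ)) * (R * T ^ (if sign then 2 else 6))

/-- The product `Vₙ ⋯ V₁ U` of all factors of a normal form but the leftmost. -/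
def normalFormTail (T R : M) (V : List VGate) (U : UGate) : M :=
  V.foldl (fun x v => v.val T R * x) (T * U.clifford T R)

/-- The product `W Vₙ ⋯ V₁ U` given by `T` and `R`. -/
def NormalForm.val (T R : M) (N : NormalForm) : M :=
  N.W.val T R * normalFormTail T R N.V N.U

theorem normalFormTail_append (T R : M) (V : List VGate) (v : VGate) (U : UGate) :
    normalFormTail T R (V ++ [v]) U = v.val T R * normalFormTail T R V U := by
  simp [normalFormTail]

variable {T R : M}

namespace CliffordTRelations

variable (h : CliffordTRelations T R)
include h

theorem T_pow_mod (n : ℕ) : T ^ n = T ^ (n % 8) := pow_eq_pow_mod n h.T_pow_eight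

theorem R_sq_mul_T_pow (n : ℕ) : R ^ 2 * T ^ n = T ^ (7 * n) * R ^ 2 := by
  induction n with
  | zero => simp
  | succ n ih =>
    rw [pow_succ T, ← mul_assoc, ih, mul_assoc, h.R_sq_mul_T, ← mul_assoc, ← pow_add]; rfl

theorem R_cubed : R ^ 3 = T ^ 4 * (R * T ^ 4) := by
  rw [← mul_assoc, h.T_pow_four_mul_R, mul_assoc, ← pow_add, h.T_pow_eight, mul_one]

theorem R_mul_T_pow_four : R * T ^ 4 = T ^ 4 * R ^ 3 := by
  rw [h.R_cubed, ← mul_assoc, ← pow_add, h.T_pow_eight, one_mul]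

theorem R_cubed_mul_T_sq : R ^ 3 * T ^ 2 = T ^ 4 * (R * T ^ 6) := by
  rw [h.R_cubed, mul_assoc, mul_assoc, ← pow_add]

theorem R_mul_T_pow_six_mul_R : R * T ^ 6 * R = T ^ 6 * (R * T ^ 6) := by
  calc R * T ^ 6 * R = R * T ^ 2 * (T ^ 4 * R) := by
        rw [show 6 = 2 + 4 from rfl, pow_add]; simp only [mul_assoc]
    _ = R * T ^ 2 * R * (R ^ 2 * T ^ 4) := by
        rw [h.T_pow_four_mul_R, show 3 = 1 + 2 from rfl, pow_add, pow_one]; simp only [mul_assoc]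
    _ = T ^ 2 * R * (T ^ 2 * T ^ (7 * 4)) * R ^ 2 := by
        rw [← h.euler, h.R_sq_mul_T_pow]; simp only [mul_assoc]
    _ = T ^ 2 * R * (T ^ (7 * 2) * R ^ 2) := by
        rw [← pow_add, h.T_pow_mod (2 + 7 * 4), h.T_pow_mod (7 * 2)]; simp only [mul_assoc]
    _ = T ^ 2 * (R ^ 3 * T ^ 2) := by
        rw [← h.R_sq_mul_T_pow, show R ^ 3 = R * R ^ 2 from pow_succ' R 2]; simp only [mul_assoc]
    _ = T ^ 6 * (R * T ^ 6) := by
        rw [h.R_cubed_mul_T_sq, ← mul_assoc, ← pow_add]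

theorem exists_eq_clifford_short (k b : ℕ) : ∃ U : UGate, T ^ (2 * k) * R ^ b = U.clifford T R := by
  refine ⟨.short ⟨k % 4, Nat.mod_lt _ (by norm_num)⟩ ⟨b % 4, Nat.mod_lt _ (by norm_num)⟩, ?_⟩
  rw [UGate.clifford, h.T_pow_mod, pow_eq_pow_mod b h.R_pow_four, h.T_pow_mod (2 * _)]
  congr 2
  simp only
  omega

theorem exists_eq_clifford_long (k : ℕ) (sign : Bool) :
    ∃ U : UGate, T ^ (2 * k) * (R * T ^ (if sign then 2 else 6)) = U.clifford T R := by
  refine ⟨.long ⟨k % 4, Nat.mod_lt _ (by norm_num)⟩ sign, ?_⟩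
  rw [UGate.clifford, h.T_pow_mod, h.T_pow_mod (2 * ((⟨k % 4, _⟩ : Fin 4) : ℕ))]
  congr 2
  simp only
  omega

/-- The 24 operators `S^a R^b` and `S^a R S^{±1}` are closed under multiplication, since they are
so under right multiplication by the generators `S` and `R`. -/
theorem exists_eq_clifford {c : M} (hc : c ∈ Submonoid.closure {T ^ 2, R}) :
    ∃ U : UGate, c = U.clifford T R := by
  induction hc using Submonoid.closure_induction_right with
  | one => exact ⟨.short 0 0, by simp [UGate.clifford]⟩
  | mul_right x _ y hy ih =>
    obtain ⟨U, rfl⟩ := ih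
    have assoc (a n : ℕ) (x : M) : T ^ (2 * a) * (T ^ (2 * n) * x) = T ^ (2 * (a + n)) * x := by
      rw [← mul_assoc, ← pow_add, ← mul_add]
    have hshort (a n b : ℕ) : ∃ U : UGate,
        T ^ (2 * a) * (T ^ (2 * n) * R ^ b) = U.clifford T R := by
      rw [assoc]; exact h.exists_eq_clifford_short _ _
    have hlong (a n : ℕ) (sign : Bool) : ∃ U : UGate,
        T ^ (2 * a) * (T ^ (2 * n) * (R * T ^ (if sign then 2 else 6))) = U.clifford T R := by
      rw [assoc]; exact h.exists_eq_clifford_long _ _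
    have key (a : ℕ) (d : M) (hd : (∃ n b, d = T ^ (2 * n) * R ^ b) ∨
        ∃ (n : ℕ) (sign : Bool), d = T ^ (2 * n) * (R * T ^ (if sign then 2 else 6))) :
        ∃ U : UGate, T ^ (2 * a) * d = U.clifford T R := by
      obtain ⟨n, b, rfl⟩ | ⟨n, sign, rfl⟩ := hd
      exacts [hshort a n b, hlong a n sign]
    obtain rfl | rfl := hy
    · cases U with
      | short a b =>
        rw [UGate.clifford, mul_assoc]
        refine key _ _ ?_
        fin_cases b
        · exact .inl ⟨1, 0, by simp⟩
        · exact .inr ⟨0, true, by simp⟩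
        · refine .inl ⟨7, 2, ?_⟩
          exact h.R_sq_mul_T_pow 2
        · refine .inr ⟨2, false, ?_⟩
          exact h.R_cubed_mul_T_sq
      | long a sign =>
        rw [UGate.clifford, mul_assoc, mul_assoc, ← pow_add]
        refine key _ _ ?_
        cases sign
        · exact .inl ⟨0, 1, by simp [h.T_pow_eight]⟩
        · refine .inl ⟨2, 3, ?_⟩
          exact h.R_mul_T_pow_four
    · cases U with
      | short a b =>
        rw [UGate.clifford, mul_assoc, ← pow_succ]
        exact h.exists_eq_clifford_short _ _
      | long a sign =>
        rw [UGate.clifford, mul_assoc]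
        refine key _ _ ?_
        cases sign
        · refine .inr ⟨3, false, ?_⟩
          exact h.R_mul_T_pow_six_mul_R
        · refine .inr ⟨1, true, ?_⟩
          simpa [mul_assoc] using h.euler.symm

omit h in
theorem clifford_mem (U : UGate) : U.clifford T R ∈ Submonoid.closure {T ^ 2, R} := by
  have hS : T ^ 2 ∈ Submonoid.closure {T ^ 2, R} := Submonoid.subset_closure (by simp)
  have hR : R ∈ Submonoid.closure {T ^ 2, R} := Submonoid.subset_closure (by simp)
  have hT (n : ℕ) : T ^ (2 * n) ∈ Submonoid.closure {T ^ 2, R} := by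
    rw [pow_mul]; exact Submonoid.pow_mem _ hS n
  cases U with
  | short a b => exact Submonoid.mul_mem _ (hT _) (Submonoid.pow_mem _ hR _)
  | long a sign =>
    refine Submonoid.mul_mem _ (hT _) (Submonoid.mul_mem _ hR ?_)
    cases sign
    exacts [hT 3, hT 1]

/-- An operator generated by `S` and `R²` passes a factor from `𝒱` at the cost of changing both. -/
theorem exists_mul_vGate {p : M} (hp : p ∈ Submonoid.closure {T ^ 2, R ^ 2}) (v : VGate) :
    ∃ v' : VGate, ∃ p' ∈ Submonoid.closure {T ^ 2, R ^ 2}, p * v.val T R = v'.val T R * p' := by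
  have hS : T ^ 2 ∈ Submonoid.closure {T ^ 2, R ^ 2} := Submonoid.subset_closure (by simp)
  have hX : R ^ 2 ∈ Submonoid.closure {T ^ 2, R ^ 2} := Submonoid.subset_closure (by simp)
  have hZ : T ^ 4 ∈ Submonoid.closure {T ^ 2, R ^ 2} := by
    rw [show 4 = 2 + 2 from rfl, pow_add]; exact Submonoid.mul_mem _ hS hS
  have hR3 : R ^ 3 = R * R ^ 2 := pow_succ' R 2
  induction hp using Submonoid.closure_induction_left generalizing v with
  | one => exact ⟨v, 1, Submonoid.one_mem _, by simp⟩
  | mul_left x hx y _ ih =>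
    obtain ⟨v', p', hp', e⟩ := ih v
    suffices H : ∃ w : VGate, ∃ q ∈ Submonoid.closure {T ^ 2, R ^ 2},
        x * v'.val T R = w.val T R * q by
      obtain ⟨w, q, hq, e'⟩ := H
      exact ⟨w, q * p', Submonoid.mul_mem _ hq hp', by
        rw [mul_assoc, e, ← mul_assoc, e', mul_assoc]⟩
    obtain rfl | rfl := hx
    · cases v' with
      | TR =>
        refine ⟨.TSR, 1, Submonoid.one_mem _, ?_⟩
        rw [VGate.val, VGate.val, ← mul_assoc, ← pow_succ, mul_one]
      | TSR =>
        refine ⟨.TR, R ^ 2 * T ^ 4, Submonoid.mul_mem _ hX hZ, ?_⟩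
        calc T ^ 2 * (T ^ 3 * R) = T * (T ^ 4 * R) := by
              rw [← mul_assoc, ← mul_assoc, ← pow_add, ← pow_succ']
          _ = T * R * (R ^ 2 * T ^ 4) := by
              rw [h.T_pow_four_mul_R, hR3]; simp only [mul_assoc]
    · cases v' with
      | TR =>
        refine ⟨.TSR, T ^ 4, hZ, ?_⟩
        calc R ^ 2 * (T * R) = T ^ 7 * R ^ 3 := by
              rw [← mul_assoc, h.R_sq_mul_T, mul_assoc, ← pow_succ]
          _ = T ^ 3 * R * T ^ 4 := by
              rw [h.R_cubed, ← mul_assoc, ← pow_add, h.T_pow_mod (7 + 4), mul_assoc]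
      | TSR =>
        refine ⟨.TR, T ^ 4, hZ, ?_⟩
        calc R ^ 2 * (T ^ 3 * R) = T ^ 21 * R ^ 3 := by
              rw [← mul_assoc, h.R_sq_mul_T_pow, mul_assoc, ← pow_succ]
          _ = T * R * T ^ 4 := by
              rw [h.R_cubed, ← mul_assoc, ← pow_add, h.T_pow_mod (21 + 4), mul_assoc]; simp

theorem exists_mul_uGate {p : M} (hp : p ∈ Submonoid.closure {T ^ 2, R ^ 2}) (U : UGate) :
    ∃ U' : UGate, p * (T * U.clifford T R) = T * U'.clifford T R := by
  have hS : T ^ 2 ∈ Submonoid.closure {T ^ 2, R} := Submonoid.subset_closure (by simp)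
  have hR : R ∈ Submonoid.closure {T ^ 2, R} := Submonoid.subset_closure (by simp)
  induction hp using Submonoid.closure_induction_left with
  | one => exact ⟨U, by simp⟩
  | mul_left x hx y _ ih =>
    obtain ⟨U', e⟩ := ih
    rw [mul_assoc, e]
    obtain rfl | rfl := hx
    · obtain ⟨U'', e'⟩ := h.exists_eq_clifford (Submonoid.mul_mem _ hS (clifford_mem U'))
      refine ⟨U'', ?_⟩
      rw [← e', ← mul_assoc, ← mul_assoc, ← pow_succ, ← pow_succ']
    · obtain ⟨U'', e'⟩ := h.exists_eq_clifford (Submonoid.mul_mem _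
        (Submonoid.mul_mem _ (Submonoid.pow_mem _ hS 3) (Submonoid.pow_mem _ hR 2))
        (clifford_mem U'))
      refine ⟨U'', ?_⟩
      rw [← e', ← mul_assoc, h.R_sq_mul_T, ← pow_mul]
      simp only [← mul_assoc, ← pow_succ']

/-- The products `Vₙ ⋯ V₁ U` absorb left factors generated by `S` and `R²`: these pass every `V`
and disappear in `U`. -/
theorem exists_mul_tail {p : M} (hp : p ∈ Submonoid.closure {T ^ 2, R ^ 2}) (V : List VGate)
    (U : UGate) : ∃ V' U', p * normalFormTail T R V U = normalFormTail T R V' U' := by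
  induction V using List.reverseRecOn generalizing p with
  | nil =>
    obtain ⟨U', e⟩ := h.exists_mul_uGate hp U
    exact ⟨[], U', e⟩
  | append_singleton V v ih =>
    obtain ⟨v', p', hp', e⟩ := h.exists_mul_vGate hp v
    obtain ⟨V', U', e'⟩ := ih hp'
    exact ⟨V' ++ [v'], U', by
      rw [normalFormTail_append, normalFormTail_append, ← e', ← mul_assoc, e, mul_assoc]⟩

/-- Every product of `T` and `R` is Clifford or a normal form, since the union of these two sets is
closed under left multiplication by `T` and `R`. -/
theorem clifford_or_normalForm {x : M} (hx : x ∈ Submonoid.closure {T, R}) :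
    x ∈ Submonoid.closure {T ^ 2, R} ∨ ∃ N : NormalForm, x = N.val T R := by
  have hS : T ^ 2 ∈ Submonoid.closure {T ^ 2, R} := Submonoid.subset_closure (by simp)
  have hR : R ∈ Submonoid.closure {T ^ 2, R} := Submonoid.subset_closure (by simp)
  have hS' : T ^ 2 ∈ Submonoid.closure {T ^ 2, R ^ 2} := Submonoid.subset_closure (by simp)
  have hX' : R ^ 2 ∈ Submonoid.closure {T ^ 2, R ^ 2} := Submonoid.subset_closure (by simp)
  induction hx using Submonoid.closure_induction_left with
  | one => exact .inl (Submonoid.one_mem _)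
  | mul_left g hg y _ ih =>
    obtain rfl | rfl := hg
    · obtain hy | ⟨⟨W, V, U⟩, rfl⟩ := ih
      · obtain ⟨U, rfl⟩ := h.exists_eq_clifford hy
        exact .inr ⟨⟨.I, [], U⟩, by simp [NormalForm.val, normalFormTail, WGate.val]⟩
      · cases W with
        | I =>
          rw [NormalForm.val, WGate.val, one_mul]
          rcases List.eq_nil_or_concat' V with rfl | ⟨V, v, rfl⟩
          · left
            rw [normalFormTail, List.foldl_nil, ← mul_assoc, ← sq]
            exact Submonoid.mul_mem _ hS (clifford_mem U)
          · right
            rw [normalFormTail_append]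
            cases v with
            | TR => exact ⟨⟨.SR, V, U⟩, by
                simp only [NormalForm.val, WGate.val, VGate.val, ← mul_assoc, sq]⟩
            | TSR =>
              obtain ⟨V', U', e⟩ := h.exists_mul_tail (Submonoid.mul_mem _ hX'
                (Submonoid.mul_mem _ hS' hS')) V U
              refine ⟨⟨.R, V', U'⟩, ?_⟩
              rw [NormalForm.val, ← e, WGate.val, VGate.val, ← mul_assoc, ← mul_assoc, ← pow_succ',
                h.T_pow_four_mul_R, ← mul_assoc, ← mul_assoc, ← pow_succ', ← pow_add]
        | R => exact .inr ⟨⟨.I, V ++ [.TR], U⟩, by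
            simp only [NormalForm.val, WGate.val, VGate.val, normalFormTail_append, one_mul,
              mul_assoc]⟩
        | SR => exact .inr ⟨⟨.I, V ++ [.TSR], U⟩, by
            simp only [NormalForm.val, WGate.val, VGate.val, normalFormTail_append, one_mul,
              ← mul_assoc, ← pow_succ']⟩
    · obtain hy | ⟨⟨W, V, U⟩, rfl⟩ := ih
      · exact .inl (Submonoid.mul_mem _ hR hy)
      · right
        cases W with
        | I => exact ⟨⟨.R, V, U⟩, by simp only [NormalForm.val, WGate.val, one_mul]⟩
        | R =>
          obtain ⟨V', U', e⟩ := h.exists_mul_tail hX' V U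
          refine ⟨⟨.I, V', U'⟩, ?_⟩
          rw [NormalForm.val, NormalForm.val, ← e, WGate.val, WGate.val, one_mul, ← mul_assoc, sq]
        | SR =>
          obtain ⟨V', U', e⟩ := h.exists_mul_tail hS' V U
          refine ⟨⟨.SR, V', U'⟩, ?_⟩
          rw [NormalForm.val, NormalForm.val, ← e, WGate.val, ← mul_assoc, ← mul_assoc, ← mul_assoc,
            h.euler]

end CliffordTRelations

end Existence

/-! ### Line diagrams as products of gates -/

section Lines

variable {P : AddSubgroup Real.Angle} (hP : ((Real.pi / 4 : ℝ) : Real.Angle) ∈ P)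

theorem had_mem (N : Submonoid (LineMonoid P)) (hS : gate hP .green 2 ∈ N)
    (hR : gate hP .red 2 ∈ N) : had P ∈ N := by
  rw [had_eq hP .green]
  exact N.mul_mem (N.mul_mem hS hR) hS

theorem gate_green_natCast_mem (n : ℕ) : gate hP .green n ∈
    Submonoid.closure {gate hP .green 1, gate hP .red 2} := by
  rw [gate_natCast]
  exact Submonoid.pow_mem _ (Submonoid.subset_closure (by simp)) n

theorem mk_mem_closure_of_isLine {D : Diagram 1 1} (h : IsLine (Real.pi / 4) D) :
    LineMonoid.mk D (h.phasesIn hP) ∈ Submonoid.closure {gate hP .green 1, gate hP .red 2} := by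
  have hR : gate hP .red 2 ∈ Submonoid.closure {gate hP .green 1, gate hP .red 2} :=
    Submonoid.subset_closure (by simp)
  have hH := had_mem hP _ (gate_green_natCast_mem hP 2) hR
  induction h with
  | wire => exact Submonoid.one_mem _
  | hadamard => exact hH
  | phase c k =>
    have hc : gate hP c 1 ∈ Submonoid.closure {gate hP .green 1, gate hP .red 2} := by
      cases c with
      | green => exact gate_green_natCast_mem hP 1
      | red =>
        rw [show gate hP .red 1 = had P * gate hP .green 1 * had P from
          (had_mul_gate_mul_had hP .green 1).symm]
        exact Submonoid.mul_mem _ (Submonoid.mul_mem _ hH (gate_green_natCast_mem hP 1)) hH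
    have := gate_mul_mem hP c k 1 _ hc
    rwa [mul_one] at this
  | comp hD hE ih ih' => exact Submonoid.mul_mem _ ih' ih

theorem exists_mk_mem_closure_of_isLine {D : Diagram 1 1} (h : IsLine (Real.pi / 2) D) :
    ∃ hD : D.PhasesIn (P : Set Real.Angle), LineMonoid.mk D hD ∈
      Submonoid.closure {gate hP .green 1 ^ 2, gate hP .red 2} := by
  have hR : gate hP .red 2 ∈ Submonoid.closure {gate hP .green 1 ^ 2, gate hP .red 2} :=
    Submonoid.subset_closure (by simp)
  have hS : gate hP .green 2 ∈ Submonoid.closure {gate hP .green 1 ^ 2, gate hP .red 2} := by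
    rw [show gate hP .green 2 = gate hP .green 1 ^ 2 from gate_natCast hP .green 2]
    exact Submonoid.subset_closure (by simp)
  induction h with
  | wire => exact ⟨trivial, Submonoid.one_mem _⟩
  | hadamard => exact ⟨trivial, had_mem hP _ hS hR⟩
  | phase c k =>
    have e : (k * (Real.pi / 2) : ℝ) = ((k * 2 : ℤ) * (Real.pi / 4) : ℝ) := by push_cast; ring
    rw [e]
    refine ⟨phasesIn_phase (int_mul_pi_div_four_mem hP _), gate_mul_mem hP c k 2 _ ?_⟩
    cases c with
    | green => exact hS
    | red => exact hR
  | comp _ _ ih ih' =>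
    obtain ⟨hD, h⟩ := ih
    obtain ⟨hE, h'⟩ := ih'
    exact ⟨⟨hD, hE⟩, Submonoid.mul_mem _ h' h⟩

theorem exists_isLine_of_mem_closure {x : LineMonoid P}
    (hx : x ∈ Submonoid.closure {gate hP .green 1 ^ 2, gate hP .red 2}) :
    ∃ (C : Diagram 1 1) (hC : C.PhasesIn (P : Set Real.Angle)),
      IsLine (Real.pi / 2) C ∧ x = LineMonoid.mk C hC := by
  have gen (c : Colour) : ∃ (C : Diagram 1 1) (hC : C.PhasesIn (P : Set Real.Angle)),
      IsLine (Real.pi / 2) C ∧ gate hP c 2 = LineMonoid.mk C hC := by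
    have e : (((1 : ℤ) : ℝ) * (Real.pi / 2)) = ((2 : ℤ) * (Real.pi / 4) : ℝ) := by push_cast; ring
    have h := IsLine.phase (θ := Real.pi / 2) c 1
    rw [e] at h
    exact ⟨_, _, h, rfl⟩
  induction hx using Submonoid.closure_induction with
  | mem x hx =>
    obtain rfl | rfl := hx
    · rw [show gate hP .green 1 ^ 2 = gate hP .green 2 from (gate_natCast hP .green 2).symm]
      exact gen .green
    · exact gen .red
  | one => exact ⟨_, _, .wire, rfl⟩
  | mul x y _ _ ih ih' =>
    obtain ⟨C, hC, h, rfl⟩ := ih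
    obtain ⟨C', hC', h', rfl⟩ := ih'
    exact ⟨C'.comp C, ⟨hC', hC⟩, .comp h' h, rfl⟩

theorem exists_mk_phase_eq_gate (c : Colour) (x : ℝ) (k : ℤ) (h : x = k * (Real.pi / 4)) :
    ∃ hx : (phase c (x : Real.Angle)).PhasesIn (P : Set Real.Angle),
      LineMonoid.mk (phase c x) hx = gate hP c k := by
  subst h
  exact ⟨_, rfl⟩

theorem exists_mk_comp {D E : Diagram 1 1} {x y : LineMonoid P}
    (hD : ∃ h : D.PhasesIn (P : Set Real.Angle), LineMonoid.mk D h = x)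
    (hE : ∃ h : E.PhasesIn (P : Set Real.Angle), LineMonoid.mk E h = y) :
    ∃ h : (D.comp E).PhasesIn (P : Set Real.Angle), LineMonoid.mk (D.comp E) h = y * x := by
  obtain ⟨hD, rfl⟩ := hD
  obtain ⟨hE, rfl⟩ := hE
  exact ⟨⟨hD, hE⟩, rfl⟩

theorem gate_red_two_pow (b : ℕ) : gate hP .red 2 ^ b = gate hP .red (b * 2) :=
  (gate_natCast_mul hP .red b 2).symm

theorem exists_mk_wGate (W : WGate) : ∃ h : W.diagram.PhasesIn (P : Set Real.Angle),
    LineMonoid.mk W.diagram h = W.val (gate hP .green 1) (gate hP .red 2) := by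
  cases W with
  | I => exact ⟨trivial, rfl⟩
  | R => exact exists_mk_phase_eq_gate hP .red _ 2 (by push_cast; ring)
  | SR =>
    rw [WGate.val, ← gate_natCast]
    exact exists_mk_comp (exists_mk_phase_eq_gate hP .red _ 2 (by push_cast; ring))
      (exists_mk_phase_eq_gate hP .green _ _ (by push_cast; ring))

theorem exists_mk_vGate (v : VGate) : ∃ h : v.diagram.PhasesIn (P : Set Real.Angle),
    LineMonoid.mk v.diagram h = v.val (gate hP .green 1) (gate hP .red 2) := by
  cases v with
  | TR =>
    exact exists_mk_comp (exists_mk_phase_eq_gate hP .red _ 2 (by push_cast; ring))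
      (exists_mk_phase_eq_gate hP .green _ _ (by push_cast; ring))
  | TSR =>
    rw [VGate.val, ← gate_natCast]
    exact exists_mk_comp (exists_mk_phase_eq_gate hP .red _ 2 (by push_cast; ring))
      (exists_mk_phase_eq_gate hP .green _ _ (by push_cast; ring))

theorem exists_mk_uGate (U : UGate) : ∃ h : U.diagram.PhasesIn (P : Set Real.Angle),
    LineMonoid.mk U.diagram h =
      gate hP .green 1 * U.clifford (gate hP .green 1) (gate hP .red 2) := by
  cases U with
  | short a b =>
    rw [UGate.clifford, ← mul_assoc, ← pow_succ', ← gate_natCast, gate_red_two_pow]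
    exact exists_mk_comp (exists_mk_phase_eq_gate hP .red _ _ (by push_cast; ring))
      (exists_mk_phase_eq_gate hP .green _ _ (by push_cast; ring))
  | long a sign =>
    rw [UGate.clifford, ← mul_assoc, ← pow_succ', ← gate_natCast]
    refine exists_mk_comp (exists_mk_comp ?_
      (exists_mk_phase_eq_gate hP .red _ 2 (by push_cast; ring)))
      (exists_mk_phase_eq_gate hP .green _ _ (by push_cast; ring))
    rw [← gate_natCast]
    cases sign with
    | true => exact exists_mk_phase_eq_gate hP .green _ _ (by push_cast; simp; ring)
    | false =>
      -- The phases `-π / 2` and `6 * π / 4` are the same angle.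
      rw [show ((if false = true then 2 else 6 : ℕ) : ℤ) = -2 + 8 from rfl, gate_add_eight]
      exact exists_mk_phase_eq_gate hP .green _ _ (by push_cast; simp; ring)

/-- The diagram of a normal form represents the product of its factors. -/
theorem exists_mk_normalForm (N : NormalForm) : ∃ h : N.diagram.PhasesIn (P : Set Real.Angle),
    LineMonoid.mk N.diagram h = N.val (gate hP .green 1) (gate hP .red 2) := by
  obtain ⟨W, V, U⟩ := N
  refine exists_mk_comp ?_ (exists_mk_wGate hP W)
  induction V using List.reverseRecOn with
  | nil => exact exists_mk_uGate hP U
  | append_singleton V v ih =>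
    rw [normalFormTail_append, List.foldl_append]
    exact exists_mk_comp ih (exists_mk_vGate hP v)

end Lines

/-! ### The Bloch representation over `ℤ[√2]` -/

section Bloch

open Matrix

/-- The Pauli matrices `X, Y, Z`. -/
def pauli : Fin 3 → Matrix (Fin 2) (Fin 2) ℂ :=
  ![!![0, 1; 1, 0], !![0, -Complex.I; Complex.I, 0], !![1, 0; 0, -1]]

theorem sqrt_two_mul_sqrt_two : (Real.sqrt 2 : ℂ) * (Real.sqrt 2 : ℂ) = ((2 : ℤ) : ℂ) := by
  rw [← Complex.ofReal_mul]; norm_num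

/-- The embedding of `ℤ[√2]` into the complex numbers. -/
noncomputable def toComplex : Zsqrtd 2 →+* ℂ :=
  Zsqrtd.lift ⟨(Real.sqrt 2 : ℂ), sqrt_two_mul_sqrt_two⟩

theorem toComplex_sqrtd : toComplex Zsqrtd.sqrtd = (Real.sqrt 2 : ℂ) := by
  simp [toComplex]

theorem toComplex_injective : Function.Injective toComplex :=
  Zsqrtd.lift_injective _ fun n h => by
    have h1 : n.natAbs * n.natAbs = 2 := by
      rw [← Int.natAbs_mul, ← h]; rfl
    have h2 : n.natAbs < 2 := by nlinarith
    interval_cases n.natAbs <;> omega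

instance : IsDomain (Zsqrtd 2) := toComplex_injective.isDomain _

/-- `B / √2 ^ k` is the matrix of the rotation of the Bloch sphere given by the operator `A`, that
is, of `ρ ↦ A ρ A⁻¹` in the basis of Pauli matrices. It does not change if `A` is scaled. -/
structure IsBloch (A : Matrix (Fin 2) (Fin 2) ℂ) (k : ℕ) (B : Matrix (Fin 3) (Fin 3) (Zsqrtd 2)) :
    Prop where
  isUnit : IsUnit A
  mul_pauli (j : Fin 3) :
    toComplex (Zsqrtd.sqrtd ^ k) • (A * pauli j) = ∑ i, toComplex (B i j) • (pauli i * A)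

theorem IsBloch.one : IsBloch 1 0 1 :=
  ⟨isUnit_one, fun j => by simp [Matrix.one_apply, ite_smul, apply_ite]⟩

theorem IsBloch.mul {A A' : Matrix (Fin 2) (Fin 2) ℂ} {k k' : ℕ}
    {B B' : Matrix (Fin 3) (Fin 3) (Zsqrtd 2)} (h : IsBloch A k B) (h' : IsBloch A' k' B') :
    IsBloch (A * A') (k + k') (B * B') := by
  refine ⟨h.isUnit.mul h'.isUnit, fun j => ?_⟩
  calc toComplex (Zsqrtd.sqrtd ^ (k + k')) • (A * A' * pauli j)
      = toComplex (Zsqrtd.sqrtd ^ k) • (A * toComplex (Zsqrtd.sqrtd ^ k') • (A' * pauli j)) := by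
        rw [pow_add, map_mul, mul_smul, Matrix.mul_smul, Matrix.mul_assoc]
    _ = ∑ l, toComplex (B' l j) • (toComplex (Zsqrtd.sqrtd ^ k) • (A * pauli l) * A') := by
        rw [h'.mul_pauli, Matrix.mul_sum, Finset.smul_sum]
        refine Finset.sum_congr rfl fun l _ => ?_
        rw [Matrix.mul_smul, smul_comm, Matrix.smul_mul, Matrix.mul_assoc]
    _ = ∑ i, toComplex ((B * B') i j) • (pauli i * (A * A')) := by
        simp only [h.mul_pauli, Matrix.sum_mul, Finset.smul_sum, Matrix.smul_mul, smul_smul,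
          Matrix.mul_apply, map_sum, map_mul, Finset.sum_smul, Matrix.mul_assoc]
        rw [Finset.sum_comm]
        simp only [mul_comm]

theorem IsBloch.smul {A : Matrix (Fin 2) (Fin 2) ℂ} {k : ℕ}
    {B : Matrix (Fin 3) (Fin 3) (Zsqrtd 2)} (h : IsBloch A k B) {z : ℂ} (hz : z ≠ 0) :
    IsBloch (z • A) k B := by
  refine ⟨h.isUnit.smul (Units.mk0 z hz), fun j => ?_⟩
  simp only [Matrix.smul_mul, Matrix.mul_smul]
  rw [smul_comm, h.mul_pauli, Finset.smul_sum]
  simp only [smul_comm z]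

theorem IsBloch.of_sqrtd_sq_smul {A : Matrix (Fin 2) (Fin 2) ℂ} {k : ℕ}
    {B : Matrix (Fin 3) (Fin 3) (Zsqrtd 2)}
    (h : IsBloch A (k + 2) ((Zsqrtd.sqrtd ^ 2 : Zsqrtd 2) • B)) : IsBloch A k B := by
  refine ⟨h.isUnit, fun j => ?_⟩
  have h2 : toComplex (Zsqrtd.sqrtd ^ 2) ≠ 0 := by simp [toComplex_sqrtd]
  have := h.mul_pauli j
  simp only [add_comm k, pow_add, map_mul, mul_smul, Matrix.smul_apply, smul_eq_mul,
    ← Finset.smul_sum] at this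
  exact smul_right_injective _ h2 this

/-- The Pauli matrices are linearly independent. -/
theorem eq_zero_of_sum_pauli {c : Fin 3 → ℂ} (h : ∑ i, c i • pauli i = 0) : c = 0 := by
  have h00 := congrFun (congrFun h 0) 0
  have h01 := congrFun (congrFun h 0) 1
  have h10 := congrFun (congrFun h 1) 0
  simp [Fin.sum_univ_three, pauli] at h00 h01 h10
  have h1 : c 1 = 0 := by
    linear_combination (-Complex.I / 2) * (h10 - h01) + c 1 * Complex.I_sq
  ext i
  fin_cases i
  · simpa [h1] using h01
  · exact h1
  · exact h00

/-- The Bloch matrix of an operator is unique up to the power of `√2` in its denominator. -/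
theorem IsBloch.unique {A : Matrix (Fin 2) (Fin 2) ℂ} {k k' : ℕ}
    {B B' : Matrix (Fin 3) (Fin 3) (Zsqrtd 2)} (h : IsBloch A k B) (h' : IsBloch A k' B') :
    (Zsqrtd.sqrtd ^ k' : Zsqrtd 2) • B = (Zsqrtd.sqrtd ^ k : Zsqrtd 2) • B' := by
  ext1 i j
  refine toComplex_injective (sub_eq_zero.1 ?_)
  refine congrFun (eq_zero_of_sum_pauli (c := fun i =>
    toComplex (((Zsqrtd.sqrtd ^ k' : Zsqrtd 2) • B) i j) -
      toComplex (((Zsqrtd.sqrtd ^ k : Zsqrtd 2) • B') i j)) ?_) i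
  refine h.isUnit.mul_left_injective ?_
  have e := congrArg (toComplex (Zsqrtd.sqrtd ^ k') • ·) (h.mul_pauli j)
  have e' := congrArg (toComplex (Zsqrtd.sqrtd ^ k) • ·) (h'.mul_pauli j)
  simp only [Finset.smul_sum] at e e'
  rw [smul_comm, e'] at e
  simp only [Matrix.sub_mul, Matrix.sum_mul, Matrix.smul_mul, sub_smul, Finset.sum_sub_distrib,
    Matrix.smul_apply, smul_eq_mul, map_mul, mul_smul, e, sub_self, Matrix.zero_mul]

/-- The Bloch matrix of `S`: a quarter turn about the `Z`-axis. -/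
def blochS : Matrix (Fin 3) (Fin 3) (Zsqrtd 2) := !![0, -1, 0; 1, 0, 0; 0, 0, 1]

/-- The Bloch matrix of `R`: a quarter turn about the `X`-axis. -/
def blochR : Matrix (Fin 3) (Fin 3) (Zsqrtd 2) := !![1, 0, 0; 0, 0, -1; 0, 1, 0]

/-- `√2` times the Bloch matrix of `T`, an eighth of a turn about the `Z`-axis. -/
def blochT : Matrix (Fin 3) (Fin 3) (Zsqrtd 2) := !![1, -1, 0; 1, 1, 0; 0, 0, Zsqrtd.sqrtd]

/-- The matrix of a one-qubit diagram, indexed by the two basis vectors. -/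
noncomputable def opMatrix (D : Diagram 1 1) : Matrix (Fin 2) (Fin 2) ℂ :=
  Matrix.of fun i j => interp D ![i] ![j]

theorem opMatrix_comp (D E : Diagram 1 1) : opMatrix (D.comp E) = opMatrix E * opMatrix D := by
  ext i j
  simp [opMatrix, interp_comp_apply, sum_fin_one_fun, Matrix.mul_apply]

theorem opMatrix_wires : opMatrix (Diagram.wires 1) = 1 := by
  ext i j
  fin_cases i <;> fin_cases j <;> simp [opMatrix, interp_wires]

theorem isBloch_phase_green :
    IsBloch (opMatrix (Diagram.phase .green (((1 : ℤ) : ℝ) * (Real.pi / 4) : ℝ))) 1 blochT := by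
  have h2 : (Real.sqrt 2 : ℂ) * (Real.sqrt 2 : ℂ) = 2 := by rw [sqrt_two_mul_sqrt_two]; rfl
  have hA : opMatrix (Diagram.phase .green (((1 : ℤ) : ℝ) * (Real.pi / 4) : ℝ)) =
      !![1, 0; 0, (Real.sqrt 2 : ℂ) / 2 * (1 + Complex.I)] := by
    have ht : (((((1 : ℤ) : ℝ) * (Real.pi / 4) : ℝ) : Real.Angle).toCircle : ℂ) =
        (Real.sqrt 2 : ℂ) / 2 * (1 + Complex.I) := by
      rw [Int.cast_one, one_mul, Real.Angle.coe_toCircle, Real.Angle.cos_coe, Real.Angle.sin_coe,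
        Real.cos_pi_div_four, Real.sin_pi_div_four]
      push_cast
      ring
    generalize ((((1 : ℤ) : ℝ) * (Real.pi / 4) : ℝ) : Real.Angle) = α at ht
    ext i j
    fin_cases i <;> fin_cases j <;>
      simp [opMatrix, Diagram.phase, interp_spider, phaseCoeff, ket, ht]
  rw [hA]
  refine ⟨?_, fun j => ?_⟩
  · rw [Matrix.isUnit_iff_isUnit_det, Matrix.det_fin_two_of, isUnit_iff_ne_zero]
    have hI : (1 : ℂ) + Complex.I ≠ 0 := fun h => by simpa using congrArg Complex.re h
    simp [hI]
  · ext a b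
    fin_cases j <;> fin_cases a <;> fin_cases b <;>
      simp [pauli, blochT, Fin.sum_univ_three, toComplex_sqrtd] <;>
      grind [Complex.I_sq]

theorem isBloch_phase_red :
    IsBloch (opMatrix (Diagram.phase .red (((2 : ℤ) : ℝ) * (Real.pi / 4) : ℝ))) 0 blochR := by
  have h2 : (Real.sqrt 2 : ℂ)⁻¹ * (Real.sqrt 2 : ℂ)⁻¹ = 1 / 2 := by
    rw [← mul_inv, sqrt_two_mul_sqrt_two]; norm_num
  have hA : opMatrix (Diagram.phase .red (((2 : ℤ) : ℝ) * (Real.pi / 4) : ℝ)) =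
      !![(1 + Complex.I) / 2, (1 - Complex.I) / 2; (1 - Complex.I) / 2, (1 + Complex.I) / 2] := by
    rw [show ((2 : ℤ) : ℝ) * (Real.pi / 4) = Real.pi / 2 by push_cast; ring]
    ext i j
    fin_cases i <;> fin_cases j <;>
      simp [opMatrix, Diagram.phase, interp_spider, phaseCoeff, ket] <;> grind
  rw [hA]
  refine ⟨?_, fun j => ?_⟩
  · rw [Matrix.isUnit_iff_isUnit_det, Matrix.det_fin_two_of, isUnit_iff_ne_zero,
      show (1 + Complex.I) / 2 * ((1 + Complex.I) / 2) -
        (1 - Complex.I) / 2 * ((1 - Complex.I) / 2) = Complex.I by ring]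
    exact Complex.I_ne_zero
  · ext a b
    fin_cases j <;> fin_cases a <;> fin_cases b <;>
      simp [pauli, blochR, Fin.sum_univ_three] <;>
      grind [Complex.I_sq]

theorem blochT_sq : blochT * blochT = (Zsqrtd.sqrtd ^ 2 : Zsqrtd 2) • blochS := by
  decide +kernel

/-- The operator matrix of a class of diagrams has the given Bloch matrix. -/
def LineMonoid.IsBloch {P : AddSubgroup Real.Angle} (x : LineMonoid P) (k : ℕ)
    (B : Matrix (Fin 3) (Fin 3) (Zsqrtd 2)) : Prop :=
  ∃ D hD, x = .mk D hD ∧ ZX.IsBloch (opMatrix D) k B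

namespace LineMonoid.IsBloch

variable {P : AddSubgroup Real.Angle} {x y : LineMonoid P} {k l : ℕ}
  {B B' : Matrix (Fin 3) (Fin 3) (Zsqrtd 2)}

theorem one : (1 : LineMonoid P).IsBloch 0 1 :=
  ⟨_, _, rfl, opMatrix_wires ▸ ZX.IsBloch.one⟩

theorem mul (h : x.IsBloch k B) (h' : y.IsBloch l B') : (x * y).IsBloch (k + l) (B * B') := by
  obtain ⟨D, hD, rfl, h⟩ := h
  obtain ⟨E, hE, rfl, h'⟩ := h'
  exact ⟨E.comp D, ⟨hE, hD⟩, rfl, opMatrix_comp E D ▸ h.mul h'⟩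

theorem pow (h : x.IsBloch 0 B) (n : ℕ) : (x ^ n).IsBloch 0 (B ^ n) := by
  induction n with
  | zero => simpa using one
  | succ n ih => rw [pow_succ, pow_succ]; exact ih.mul h

theorem of_sqrtd_sq_smul (h : x.IsBloch (k + 2) ((Zsqrtd.sqrtd ^ 2 : Zsqrtd 2) • B)) :
    x.IsBloch k B := by
  obtain ⟨D, hD, rfl, h⟩ := h
  exact ⟨D, hD, rfl, h.of_sqrtd_sq_smul⟩

end LineMonoid.IsBloch

theorem EqUpToScalar.opMatrix {D E : Diagram 1 1} (h : EqUpToScalar (interp D) (interp E)) :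
    ∃ z : ℂ, z ≠ 0 ∧ opMatrix D = z • opMatrix E := by
  obtain ⟨z, hz, h⟩ := h
  exact ⟨z, hz, by ext i j; simp [ZX.opMatrix, h]⟩

/-- Diagrams with the same operator up to a scalar have the same Bloch matrix. -/
theorem LineMonoid.IsBloch.eq_of_eqUpToScalar {P : AddSubgroup Real.Angle} {D E : Diagram 1 1}
    {hD : D.PhasesIn (P : Set Real.Angle)} {hE : E.PhasesIn (P : Set Real.Angle)} {k l : ℕ}
    {B B' : Matrix (Fin 3) (Fin 3) (Zsqrtd 2)} (h : (LineMonoid.mk D hD).IsBloch k B)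
    (h' : (LineMonoid.mk E hE).IsBloch l B') (hDE : EqUpToScalar (interp D) (interp E)) :
    (Zsqrtd.sqrtd ^ l : Zsqrtd 2) • B = (Zsqrtd.sqrtd ^ k : Zsqrtd 2) • B' := by
  obtain ⟨D', hD', e, h⟩ := h
  obtain ⟨E', hE', e', h'⟩ := h'
  have e := (LineMonoid.mk_eq_mk.1 e).eqUpToScalar
  have e' := (LineMonoid.mk_eq_mk.1 e').eqUpToScalar
  obtain ⟨z, hz, hz'⟩ := (e.symm.trans (hDE.trans e')).opMatrix
  rw [hz'] at h
  exact h.unique (h'.smul hz)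

section Gates

variable {P : AddSubgroup Real.Angle} (hP : ((Real.pi / 4 : ℝ) : Real.Angle) ∈ P)

theorem isBloch_gate_green : (gate hP .green 1).IsBloch 1 blochT :=
  ⟨_, _, rfl, isBloch_phase_green⟩

theorem isBloch_gate_red : (gate hP .red 2).IsBloch 0 blochR :=
  ⟨_, _, rfl, isBloch_phase_red⟩

theorem isBloch_gate_green_sq : (gate hP .green 1 ^ 2).IsBloch 0 blochS := by
  rw [sq]
  exact .of_sqrtd_sq_smul (blochT_sq ▸ (isBloch_gate_green hP).mul (isBloch_gate_green hP))

end Gates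

/-- The Bloch matrix of an element of `𝒲`. -/
def WGate.bloch : WGate → Matrix (Fin 3) (Fin 3) (Zsqrtd 2)
  | .I => 1
  | .R => blochR
  | .SR => blochS * blochR

/-- The element of `𝒲` that remains of an element of `𝒱` when its `T` is removed. -/
def VGate.toWGate : VGate → WGate
  | .TR => .R
  | .TSR => .SR

/-- The Bloch matrix of the Clifford operator `C` in the element `TC` of `𝒰`, with `S⁻¹` written as
`S ^ 3`. -/
def UGate.bloch : UGate → Matrix (Fin 3) (Fin 3) (Zsqrtd 2)
  | .short a b => blochS ^ (a : ℕ) * blochR ^ (b : ℕ)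
  | .long a sign => blochS ^ (a : ℕ) * (blochR * blochS ^ (if sign then 1 else 3))

/-- The Bloch matrix of `Vₙ ⋯ V₁ U`, multiplied by `√2 ^ (n + 1)`. -/
def blochTail (V : List VGate) (U : UGate) : Matrix (Fin 3) (Fin 3) (Zsqrtd 2) :=
  V.foldl (fun B v => blochT * (v.toWGate.bloch * B)) (blochT * U.bloch)

theorem blochTail_append (V : List VGate) (v : VGate) (U : UGate) :
    blochTail (V ++ [v]) U = blochT * (v.toWGate.bloch * blochTail V U) := by
  simp [blochTail]

section NormalForms

variable {P : AddSubgroup Real.Angle} (hP : ((Real.pi / 4 : ℝ) : Real.Angle) ∈ P)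

theorem isBloch_wGate (W : WGate) :
    (W.val (gate hP .green 1) (gate hP .red 2)).IsBloch 0 W.bloch := by
  cases W with
  | I => exact .one
  | R => exact isBloch_gate_red hP
  | SR => exact (isBloch_gate_green_sq hP).mul (isBloch_gate_red hP)

theorem isBloch_clifford (U : UGate) :
    (U.clifford (gate hP .green 1) (gate hP .red 2)).IsBloch 0 U.bloch := by
  have hS := isBloch_gate_green_sq hP
  have hR := isBloch_gate_red hP
  cases U with
  | short a b =>
    rw [UGate.clifford, pow_mul]
    exact (hS.pow a).mul (hR.pow b)
  | long a sign =>
    rw [UGate.clifford, pow_mul]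
    refine (hS.pow a).mul (hR.mul (l := 0) ?_)
    cases sign with
    | true => exact (pow_one blochS).symm ▸ hS
    | false =>
      have := hS.pow 3
      rwa [← pow_mul] at this

theorem isBloch_tail (V : List VGate) (U : UGate) :
    (normalFormTail (gate hP .green 1) (gate hP .red 2) V U).IsBloch (V.length + 1)
      (blochTail V U) := by
  induction V using List.reverseRecOn with
  | nil => exact (add_comm 1 0) ▸ (isBloch_gate_green hP).mul (isBloch_clifford hP U)
  | append_singleton V v ih =>
    have hv : v.val (gate hP .green 1) (gate hP .red 2) =
        gate hP .green 1 * v.toWGate.val (gate hP .green 1) (gate hP .red 2) := by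
      cases v with
      | TR => rfl
      | TSR => simp only [VGate.val, VGate.toWGate, WGate.val, ← mul_assoc, ← pow_succ']
    rw [normalFormTail_append, blochTail_append, hv, mul_assoc, List.length_append,
      List.length_singleton, add_comm]
    refine (isBloch_gate_green hP).mul ?_
    have := (isBloch_wGate hP v.toWGate).mul ih
    rwa [zero_add] at this

theorem isBloch_normalForm (N : NormalForm) :
    (N.val (gate hP .green 1) (gate hP .red 2)).IsBloch (N.V.length + 1)
      (N.W.bloch * blochTail N.V N.U) := by
  have := (isBloch_wGate hP N.W).mul (isBloch_tail hP N.V N.U)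
  rwa [zero_add] at this

end NormalForms

end Bloch

/-! ### Uniqueness of normal forms -/

section Uniqueness

open Matrix

/-- Reduction of `ℤ[√2]` modulo `√2`. -/
def modSqrtTwo : Zsqrtd 2 →+* ZMod 2 := Zsqrtd.lift ⟨0, by decide⟩

theorem modSqrtTwo_sqrtd : modSqrtTwo Zsqrtd.sqrtd = 0 := by
  simp [modSqrtTwo]

/-- The vector `u = (1, 1, 0)` that spans the columns of `blochT` modulo `√2`. -/
def uVec : Fin 3 → ZMod 2 := ![1, 1, 0]

theorem blochT_map : blochT.map modSqrtTwo = vecMulVec uVec uVec := by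
  decide +kernel

theorem UGate.vecMul_bloch_map_ne_zero (U : UGate) : uVec ᵥ* (U.bloch.map modSqrtTwo) ≠ 0 := by
  cases U with
  | short a b => revert a b; decide +kernel
  | long a sign => revert a sign; decide +kernel

theorem blochTail_map (V : List VGate) (U : UGate) :
    ∃ y ≠ 0, (blochTail V U).map modSqrtTwo = vecMulVec uVec y := by
  induction V using List.reverseRecOn with
  | nil =>
    refine ⟨_, U.vecMul_bloch_map_ne_zero, ?_⟩
    rw [blochTail, List.foldl_nil, Matrix.map_mul, blochT_map, vecMulVec_mul]
  | append_singleton V v ih =>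
    obtain ⟨y, hy, e⟩ := ih
    refine ⟨y, hy, ?_⟩
    have hv : vecMulVec uVec uVec *ᵥ (v.toWGate.bloch.map modSqrtTwo *ᵥ uVec) = uVec := by
      cases v <;> decide +kernel
    rw [blochTail_append, Matrix.map_mul, Matrix.map_mul, e, blochT_map, mul_vecMulVec,
      mul_vecMulVec, hv]

/-- Modulo `√2`, the columns of the Bloch matrix of a normal form are multiples of a vector that
depends on its leftmost factor only. -/
theorem normalForm_bloch_map (N : NormalForm) :
    ∃ y ≠ 0, (N.W.bloch * blochTail N.V N.U).map modSqrtTwo =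
      vecMulVec (N.W.bloch.map modSqrtTwo *ᵥ uVec) y := by
  obtain ⟨y, hy, e⟩ := blochTail_map N.V N.U
  exact ⟨y, hy, by rw [Matrix.map_mul, e, mul_vecMulVec]⟩

theorem WGate.bloch_map_mulVec_ne_zero (W : WGate) : W.bloch.map modSqrtTwo *ᵥ uVec ≠ 0 := by
  cases W <;> decide +kernel

theorem WGate.eq_of_bloch_map_mulVec_eq {W W' : WGate}
    (h : W.bloch.map modSqrtTwo *ᵥ uVec = W'.bloch.map modSqrtTwo *ᵥ uVec) : W = W' := by
  cases W <;> cases W' <;> first | rfl | exact absurd h (by decide +kernel)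

theorem vecMulVec_ne_zero_zmod_two {a y : Fin 3 → ZMod 2} (ha : a ≠ 0) (hy : y ≠ 0) :
    vecMulVec a y ≠ 0 := by
  intro h
  obtain ⟨i, hi⟩ := Function.ne_iff.1 ha
  obtain ⟨j, hj⟩ := Function.ne_iff.1 hy
  exact mul_ne_zero hi hj (congrFun (congrFun h i) j)

theorem eq_of_vecMulVec_eq {a a' y y' : Fin 3 → ZMod 2} (ha : a ≠ 0) (hy : y ≠ 0)
    (h : vecMulVec a y = vecMulVec a' y') : a = a' := by
  have one_of_ne : ∀ x : ZMod 2, x ≠ 0 → x = 1 := by decide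
  obtain ⟨i, hi⟩ := Function.ne_iff.1 ha
  obtain ⟨j, hj⟩ := Function.ne_iff.1 hy
  have e (i : Fin 3) : a i * y j = a' i * y' j := congrFun (congrFun h i) j
  have hy1 : y j = 1 := one_of_ne _ hj
  have hy1' : y' j = 1 := one_of_ne _ fun h0 => mul_ne_zero hi hj (by rw [e, h0, mul_zero])
  ext i
  simpa [hy1, hy1'] using e i

theorem normalForm_bloch_map_ne_zero (N : NormalForm) :
    (N.W.bloch * blochTail N.V N.U).map modSqrtTwo ≠ 0 := by
  obtain ⟨y, hy, e⟩ := normalForm_bloch_map N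
  rw [e]
  exact vecMulVec_ne_zero_zmod_two N.W.bloch_map_mulVec_ne_zero hy

theorem map_sqrtd_pow_smul {k : ℕ} (hk : k ≠ 0) (B : Matrix (Fin 3) (Fin 3) (Zsqrtd 2)) :
    ((Zsqrtd.sqrtd ^ k : Zsqrtd 2) • B).map modSqrtTwo = 0 := by
  ext i j
  simp [modSqrtTwo_sqrtd, hk]

theorem sqrtd_pow_ne_zero (k : ℕ) : (Zsqrtd.sqrtd ^ k : Zsqrtd 2) ≠ 0 :=
  pow_ne_zero _ (by decide)

/-- If `B / √2 ^ k = B' / √2 ^ l` with `B` not divisible by `√2`, then `k` is the least denominator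
exponent. -/
theorem le_of_sqrtd_pow_smul_eq {k l : ℕ} {B B' : Matrix (Fin 3) (Fin 3) (Zsqrtd 2)}
    (hB : B.map modSqrtTwo ≠ 0)
    (h : (Zsqrtd.sqrtd ^ l : Zsqrtd 2) • B = (Zsqrtd.sqrtd ^ k : Zsqrtd 2) • B') : k ≤ l := by
  by_contra! hlt
  obtain ⟨d, rfl⟩ := Nat.exists_eq_add_of_lt hlt
  rw [add_assoc, pow_add, mul_smul] at h
  exact hB (smul_right_injective _ (sqrtd_pow_ne_zero l) h ▸ map_sqrtd_pow_smul (by omega) B')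

theorem WGate.bloch_mul_injective (W : WGate) {B B' : Matrix (Fin 3) (Fin 3) (Zsqrtd 2)}
    (h : W.bloch * B = W.bloch * B') : B = B' := by
  have hW : W.bloch.transpose * W.bloch = 1 := by cases W <;> decide +kernel
  simpa [← Matrix.mul_assoc, hW] using congrArg (W.bloch.transpose * ·) h

theorem blochT_mul_injective {B B' : Matrix (Fin 3) (Fin 3) (Zsqrtd 2)}
    (h : blochT * B = blochT * B') : B = B' := by
  have hT : blochT.transpose * blochT =
      (2 : Zsqrtd 2) • (1 : Matrix (Fin 3) (Fin 3) (Zsqrtd 2)) := by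
    decide +kernel
  have e := congrArg (blochT.transpose * ·) h
  simp only [← Matrix.mul_assoc, hT, Matrix.smul_mul, Matrix.one_mul] at e
  exact smul_right_injective _ (by decide : (2 : Zsqrtd 2) ≠ 0) e

/-- The 24 operators `S^a R^b` and `S^a R S^{±1}` have different Bloch matrices. -/
theorem UGate.bloch_injective {U U' : UGate} (h : U.bloch = U'.bloch) : U = U' := by
  have hss : ∀ a b a' b', (UGate.short a b).bloch = (UGate.short a' b').bloch →
      a = a' ∧ b = b' := by decide +kernel
  have hsl : ∀ a b a' s', (UGate.short a b).bloch ≠ (UGate.long a' s').bloch := by decide +kernel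
  have hll : ∀ a s a' s', (UGate.long a s).bloch = (UGate.long a' s').bloch →
      a = a' ∧ s = s' := by decide +kernel
  cases U with
  | short a b =>
    cases U' with
    | short a' b' =>
      obtain ⟨rfl, rfl⟩ := hss a b a' b' h
      rfl
    | long a' s' => exact absurd h (hsl a b a' s')
  | long a s =>
    cases U' with
    | short a' b' => exact absurd h.symm (hsl a' b' a s)
    | long a' s' =>
      obtain ⟨rfl, rfl⟩ := hll a s a' s' h
      rfl

theorem VGate.toWGate_injective : Function.Injective VGate.toWGate := by
  intro v v' h
  cases v <;> cases v' <;> first | rfl | cases h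

theorem NormalForm.W_eq_of_bloch_eq {N N' : NormalForm}
    (h : N.W.bloch * blochTail N.V N.U = N'.W.bloch * blochTail N'.V N'.U) : N.W = N'.W := by
  obtain ⟨y, hy, e⟩ := normalForm_bloch_map N
  obtain ⟨y', _, e'⟩ := normalForm_bloch_map N'
  exact WGate.eq_of_bloch_map_mulVec_eq
    (eq_of_vecMulVec_eq N.W.bloch_map_mulVec_ne_zero hy (by rw [← e, ← e', h]))

/-- A normal form is determined by the length of its word and its Bloch matrix: reduction modulo
`√2` shows the leftmost factor, which can then be removed together with the next `T`. -/
theorem NormalForm.eq_of_bloch_eq {N N' : NormalForm} (hlen : N.V.length = N'.V.length)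
    (h : N.W.bloch * blochTail N.V N.U = N'.W.bloch * blochTail N'.V N'.U) : N = N' := by
  obtain ⟨W, V, U⟩ := N
  obtain ⟨W', V', U'⟩ := N'
  induction V using List.reverseRecOn generalizing W W' V' with
  | nil =>
    obtain rfl : V' = [] := List.eq_nil_of_length_eq_zero hlen.symm
    obtain rfl : W = W' := NormalForm.W_eq_of_bloch_eq h
    obtain rfl : U = U' := UGate.bloch_injective (blochT_mul_injective (W.bloch_mul_injective h))
    rfl
  | append_singleton V v ih =>
    rcases List.eq_nil_or_concat' V' with rfl | ⟨V', v', rfl⟩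
    · simp at hlen
    · obtain rfl : W = W' := NormalForm.W_eq_of_bloch_eq h
      have h' := W.bloch_mul_injective h
      simp only [blochTail_append] at h'
      have e := ih v.toWGate v'.toWGate V' (by simpa using hlen) (blochT_mul_injective h')
      obtain ⟨e₁, rfl, rfl⟩ := NormalForm.mk.inj e
      rw [VGate.toWGate_injective e₁]

end Uniqueness

/-! ### Completeness -/

section Completeness

variable {P : AddSubgroup Real.Angle} (hP : ((Real.pi / 4 : ℝ) : Real.Angle) ∈ P)

include hP in
theorem isBloch_normalForm_diagram (N : NormalForm) :
    ∃ hN : N.diagram.PhasesIn (P : Set Real.Angle),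
      (LineMonoid.mk N.diagram hN).IsBloch (N.V.length + 1) (N.W.bloch * blochTail N.V N.U) := by
  obtain ⟨hN, e⟩ := exists_mk_normalForm hP N
  exact ⟨hN, e ▸ isBloch_normalForm hP N⟩

include hP in
theorem NormalForm.eq_of_eqUpToScalar {N N' : NormalForm}
    (h : EqUpToScalar (interp N.diagram) (interp N'.diagram)) : N = N' := by
  obtain ⟨hN, b⟩ := isBloch_normalForm_diagram hP N
  obtain ⟨hN', b'⟩ := isBloch_normalForm_diagram hP N'
  have e := b.eq_of_eqUpToScalar b' h
  have hlen : N.V.length + 1 = N'.V.length + 1 :=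
    le_antisymm (le_of_sqrtd_pow_smul_eq (normalForm_bloch_map_ne_zero N) e)
      (le_of_sqrtd_pow_smul_eq (normalForm_bloch_map_ne_zero N') e.symm)
  rw [hlen] at e
  exact NormalForm.eq_of_bloch_eq (Nat.succ_injective hlen)
    (smul_right_injective _ (sqrtd_pow_ne_zero _) e)

/-- A Clifford operator is not a normal form, since its Bloch matrix has no denominator. -/
theorem not_eqUpToScalar_clifford_normalForm {C : Diagram 1 1}
    {hC : C.PhasesIn (P : Set Real.Angle)}
    (h : LineMonoid.mk C hC ∈ Submonoid.closure {gate hP .green 1 ^ 2, gate hP .red 2})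
    (N : NormalForm) : ¬ EqUpToScalar (interp N.diagram) (interp C) := by
  intro hNC
  obtain ⟨U, hU⟩ := (cliffordTRelations hP).exists_eq_clifford h
  obtain ⟨hN, b⟩ := isBloch_normalForm_diagram hP N
  have b' : (LineMonoid.mk C hC).IsBloch 0 U.bloch := hU ▸ isBloch_clifford hP U
  have := le_of_sqrtd_pow_smul_eq (normalForm_bloch_map_ne_zero N) (b.eq_of_eqUpToScalar b' hNC)
  omega

include hP in
/-- Two Clifford+T line diagrams with the same operator are equal to the same normal form, or they
are so after composition with `T`. -/
theorem derivable_of_eqUpToScalar {D E : Diagram 1 1} (hD : IsLine (Real.pi / 4) D)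
    (hE : IsLine (Real.pi / 4) E) (h : EqUpToScalar (interp D) (interp E)) :
    Derivable (P : Set Real.Angle) D E := by
  have hT := cliffordTRelations hP
  -- Two Clifford operators are compared by means of the normal forms got by multiplying with `T`.
  have nf {x : LineMonoid P}
      (hx : x ∈ Submonoid.closure {gate hP .green 1 ^ 2, gate hP .red 2}) :
      ∃ (N : NormalForm) (hN : N.diagram.PhasesIn (P : Set Real.Angle)),
        gate hP .green 1 * x = LineMonoid.mk N.diagram hN := by
    obtain ⟨U, rfl⟩ := hT.exists_eq_clifford hx
    obtain ⟨hN, e⟩ := exists_mk_normalForm hP ⟨.I, [], U⟩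
    exact ⟨_, hN, by rw [e]; simp [NormalForm.val, WGate.val, normalFormTail]⟩
  rcases hT.clifford_or_normalForm (mk_mem_closure_of_isLine hP hD) with hDc | ⟨N, hDN⟩ <;>
    rcases hT.clifford_or_normalForm (mk_mem_closure_of_isLine hP hE) with hEc | ⟨N', hEN⟩
  · obtain ⟨N, hN, e⟩ := nf hDc
    obtain ⟨N', hN', e'⟩ := nf hEc
    have hNN : N = N' := by
      refine NormalForm.eq_of_eqUpToScalar hP ?_
      have s := (LineMonoid.mk_eq_mk.1 e).eqUpToScalar
      have s' := (LineMonoid.mk_eq_mk.1 e').eqUpToScalar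
      exact s.symm.trans (((EqUpToScalar.of_eq rfl).mul h).trans s')
    subst hNN
    refine (LineMonoid.mk_eq_mk (hD := hD.phasesIn hP) (hE := hE.phasesIn hP)).1 ?_
    have := congrArg (gate hP .green 1 ^ 7 * ·) (e.trans e'.symm)
    simpa only [← mul_assoc, ← pow_succ, hT.T_pow_eight, one_mul] using this
  · obtain ⟨hN, e⟩ := exists_mk_normalForm hP N'
    have s := (LineMonoid.mk_eq_mk.1 (hEN.trans e.symm)).eqUpToScalar
    exact absurd (s.symm.trans h.symm) (not_eqUpToScalar_clifford_normalForm hP hDc N')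
  · obtain ⟨hN, e⟩ := exists_mk_normalForm hP N
    have s := (LineMonoid.mk_eq_mk.1 (hDN.trans e.symm)).eqUpToScalar
    exact absurd (s.symm.trans h) (not_eqUpToScalar_clifford_normalForm hP hEc N)
  · obtain ⟨hN, e⟩ := exists_mk_normalForm hP N
    obtain ⟨hN', e'⟩ := exists_mk_normalForm hP N'
    have s := LineMonoid.mk_eq_mk.1 (hDN.trans e.symm)
    have s' := LineMonoid.mk_eq_mk.1 (hEN.trans e'.symm)
    obtain rfl := NormalForm.eq_of_eqUpToScalar hP
      (s.eqUpToScalar.symm.trans (h.trans s'.eqUpToScalar))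
    exact s.trans s'.symm

include hP in
theorem xor_clifford_normalForm {D : Diagram 1 1} (hD : IsLine (Real.pi / 4) D) :
    Xor (∃ C : Diagram 1 1, IsLine (Real.pi / 2) C ∧ Derivable (P : Set Real.Angle) D C)
      (∃ N : NormalForm, Derivable (P : Set Real.Angle) D N.diagram) := by
  have not_both {C : Diagram 1 1} {N : NormalForm} (hC : IsLine (Real.pi / 2) C)
      (h : Derivable (P : Set Real.Angle) D C) (h' : Derivable (P : Set Real.Angle) D N.diagram) :
      False := by
    obtain ⟨hC, hm⟩ := exists_mk_mem_closure_of_isLine hP hC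
    exact not_eqUpToScalar_clifford_normalForm hP hm N (h'.symm.trans h).eqUpToScalar
  rcases (cliffordTRelations hP).clifford_or_normalForm (mk_mem_closure_of_isLine hP hD) with
    h | ⟨N, h⟩
  · obtain ⟨C, hC, hl, e⟩ := exists_isLine_of_mem_closure hP h
    have hDC := LineMonoid.mk_eq_mk.1 e
    exact .inl ⟨⟨C, hl, hDC⟩, fun ⟨N, hN⟩ => not_both hl hDC hN⟩
  · obtain ⟨hN, e⟩ := exists_mk_normalForm hP N
    have hDN := LineMonoid.mk_eq_mk.1 (h.trans e.symm)
    exact .inr ⟨⟨N, hDN⟩, fun ⟨C, hC, hDC⟩ => not_both hC hDC hDN⟩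

end Completeness
end ZX

theorem mainTheorem4 (P : AddSubgroup Real.Angle)
    (hP : ((Real.pi / 4 : ℝ) : Real.Angle) ∈ P) :
    -- completeness (and soundness) for Clifford+T line diagrams
    (∀ D E : ZX.Diagram 1 1, ZX.IsLine (Real.pi / 4) D → ZX.IsLine (Real.pi / 4) E →
      (ZX.Derivable P D E ↔ ZX.EqUpToScalar (ZX.interp D) (ZX.interp E))) ∧
    -- either Clifford or rewritable to a normal form
    (∀ D : ZX.Diagram 1 1, ZX.IsLine (Real.pi / 4) D →
      Xor (∃ C : ZX.Diagram 1 1, ZX.IsLine (Real.pi / 2) C ∧ ZX.Derivable P D C)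
        (∃ N : ZX.NormalForm, ZX.Derivable P D N.diagram)) ∧
    -- uniqueness of the normal form, for graphical equality and for equality of operators
    (∀ N N' : ZX.NormalForm, ZX.Derivable P N.diagram N'.diagram → N = N') ∧
    (∀ N N' : ZX.NormalForm,
      ZX.EqUpToScalar (ZX.interp N.diagram) (ZX.interp N'.diagram) → N = N') :=
  ⟨fun _ _ hD hE => ⟨fun h => h.eqUpToScalar, ZX.derivable_of_eqUpToScalar hP hD hE⟩,
    fun _ hD => ZX.xor_clifford_normalForm hP hD,
    fun _ _ h => ZX.NormalForm.eq_of_eqUpToScalar hP h.eqUpToScalar,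
    fun _ _ h => ZX.NormalForm.eq_of_eqUpToScalar hP h⟩
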